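/- Let $\mathbb T=\{z_1+i_2z_2: z_1,z_2\in\mathbb C\}$ be the bicomplex numbers ($i_1$ is the unit of $\mathbb C$, $i_2^2=-1$, $j=i_1i_2$), $e_1=\frac{1+j}2$, $e_2=\frac{1-j}2$, and write $\xi=\xi_1e_1+\xi_2e_2$ with $\xi_1=z_1-i_1z_2$, $\xi_2=z_1+i_1z_2\in\mathbb C$. For $\xi=x_0+i_1x_1+i_2x_2+jx_3$ put $\operatorname{Re}\xi=x_0$, $\operatorname{Im}_j\xi=x_3$. Powers (principal branches), exponentials, the Gamma function $\Gamma_2$, series, derivatives and integrals are taken componentwise in this representation. Let $$\mathbb E^l_{m,n}(\zeta)=\sum_{u\ge0}\frac{(l)_u}{u!\,\Gamma_2(mu+n)}\zeta^u,\qquad e^l_{m,n,r}(t)=t^{n-1}\mathbb E^l_{m,n}(rt^m),\qquad (h*g)(t)=\int_0^t h(t-s)g(s)\,ds,$$ $$\mathbb E^l_{m,n,r,0+}\varphi=e^l_{m,n,r}*\varphi,\qquad {}^C\mathbb D^l_{m,n,r,0+}f=\mathbb E^{-l}_{m,\lceil n\rceil-n,r,0+}\,f^{(\lceil n\rceil)},\qquad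 \lceil n\rceil=k_1e_1+k_2e_2,\ k_i=\lceil\operatorname{Re}n_i\rceil,$$ where $f^{(\lceil n\rceil)}=f_1^{(k_1)}e_1+f_2^{(k_2)}e_2$; if $n_i=k_i$, the term $u=0$ of the kernel in the $i$-th component of $\mathbb E^{-l}_{m,\lceil n\rceil-n,r,0+}$ (formally $t^{-1}/\Gamma(0)$) is read as the Dirac mass, i.e. it contributes the identity operator. A function $f:(0,\infty)\to\mathbb T$ is said to be of class $\mathcal E$ if both components are Lebesgue integrable on $(0,b)$ for every $b>0$ and of exponential order ($|f_i(t)|\le Ce^{Mt}$ for almost all large $t$). With $\mathcal L(h;\xi)=\int_0^\infty h(t)e^{-\xi t}\,dt$, the relation $h=\mathcal L^{-1}\{F\}$ means that $h$ is of class $\mathcal E$ and, for some $M\in\mathbb R$, $\mathcal L(h;\xi)=F(\xi)$ for all $\xi$ with $\operatorname{Re}\xi>M+|\operatorname{Im}_j\xi|$; such an $h$ is unique up to null sets. **Theorem.** Let $m,n,r,\kappa,\tau_0\in\mathbb T$ with $|\operatorname{Im}_j m|<\operatorname{Re}m$, $|\operatorname{Im}_j n|<\operatorname{Re}n$, let $l=l_1e_1+l_2e_2$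 with $l_1,l_2$ real and $0<l_1,l_2<1$, and suppose that for $i=1,2$ either $n_i=k_i$ or $\operatorname{Re}n_i<k_i$ (that is, $\lceil n\rceil-n$ is an admissible order). Let $f,g:(0,\infty)\to\mathbb T$ be of class $\mathcal E$, with $f_i\in AC^{k_i}(0,b)$ for all $b>0$ and $i=1,2$ (continuous derivatives up to order $k_i-1$, and $f_i^{(k_i-1)}$ absolutely continuous), and suppose that $${}^C\mathbb D^l_{m,n,r,0+}f(t)+\kappa f(t)=g(t)\ \text{ for almost every } t>0,\qquad f(0^+)=\tau_0,$$ and, should some $\operatorname{Re}n_i$ exceed $1$, also $f_i^{(p)}(0^+)=0$ for $1\le p<k_i$. Then the inverse Laplace transforms $$h=\mathcal L^{-1}\Big\{\frac1{\xi^n(1-r\xi^{-m})^l+\kappa}\Big\},\qquad q=\mathcal L^{-1}\Big\{\frac{\xi^{n-1}(1-r\xi^{-m})^l}{\xi^n(1-r\xi^{-m})^l+\kappa}\Big\}$$ exist, and $$f(t)=(h*g)(t)+\tau_0\,q(t)\qquad\text{for almost every }t>0.$$ If $\kappa=0$, then $h(t)=t^{n-1}\mathbb E^l_{m,n}(rt^m)$,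 and $f(t)=\tau_0+\big([t^{n-1}\mathbb E^l_{m,n}(rt^m)]*g\big)(t)$ for almost every $t>0$. -/

import Mathlib

open Filter Topology MeasureTheory Set

noncomputable section

/-- Bicomplex numbers `z₁ + i₂ z₂` with `z₁ z₂ : ℂ` (the unit of `ℂ` is `i₁`) and `i₂ ^ 2 = -1`. -/
@[ext]
structure Bicomplex where
  z₁ : ℂ
  z₂ : ℂ

namespace Bicomplex

/-! ### The ring of bicomplex numbers -/

instance : Zero Bicomplex := ⟨⟨0, 0⟩⟩
instance : One Bicomplex := ⟨⟨1, 0⟩⟩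
instance : Add Bicomplex := ⟨fun a b => ⟨a.z₁ + b.z₁, a.z₂ + b.z₂⟩⟩
instance : Neg Bicomplex := ⟨fun a => ⟨-a.z₁, -a.z₂⟩⟩
instance : Sub Bicomplex := ⟨fun a b => ⟨a.z₁ - b.z₁, a.z₂ - b.z₂⟩⟩
instance : Mul Bicomplex :=
  ⟨fun a b => ⟨a.z₁ * b.z₁ - a.z₂ * b.z₂, a.z₁ * b.z₂ + a.z₂ * b.z₁⟩⟩

@[simp] theorem zero_z₁ : (0 : Bicomplex).z₁ = 0 := rfl
@[simp] theorem zero_z₂ : (0 : Bicomplex).z₂ = 0 := rfl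
@[simp] theorem one_z₁ : (1 : Bicomplex).z₁ = 1 := rfl
@[simp] theorem one_z₂ : (1 : Bicomplex).z₂ = 0 := rfl
@[simp] theorem add_z₁ (a b : Bicomplex) : (a + b).z₁ = a.z₁ + b.z₁ := rfl
@[simp] theorem add_z₂ (a b : Bicomplex) : (a + b).z₂ = a.z₂ + b.z₂ := rfl
@[simp] theorem neg_z₁ (a : Bicomplex) : (-a).z₁ = -a.z₁ := rfl
@[simp] theorem neg_z₂ (a : Bicomplex) : (-a).z₂ = -a.z₂ := rfl
@[simp] theorem sub_z₁ (a b : Bicomplex) : (a - b).z₁ = a.z₁ - b.z₁ := rfl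
@[simp] theorem sub_z₂ (a b : Bicomplex) : (a - b).z₂ = a.z₂ - b.z₂ := rfl
@[simp] theorem mul_z₁ (a b : Bicomplex) : (a * b).z₁ = a.z₁ * b.z₁ - a.z₂ * b.z₂ := rfl
@[simp] theorem mul_z₂ (a b : Bicomplex) : (a * b).z₂ = a.z₁ * b.z₂ + a.z₂ * b.z₁ := rfl

instance : CommRing Bicomplex where
  add_assoc a b c := by ext <;> simp <;> ring
  zero_add a := by ext <;> simp
  add_zero a := by ext <;> simp
  add_comm a b := by ext <;> simp <;> ring
  left_distrib a b c := by ext <;> simp <;> ring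
  right_distrib a b c := by ext <;> simp <;> ring
  zero_mul a := by ext <;> simp
  mul_zero a := by ext <;> simp
  mul_assoc a b c := by ext <;> simp <;> ring
  one_mul a := by ext <;> simp
  mul_one a := by ext <;> simp
  mul_comm a b := by ext <;> simp <;> ring
  neg_add_cancel a := by ext <;> simp
  sub_eq_add_neg a b := by ext <;> simp <;> ring
  nsmul := nsmulRec
  zsmul := zsmulRec

/-- For `ξ = x₀ + i₁ x₁ + i₂ x₂ + j x₃` with `j = i₁ i₂`, the real part `x₀`. -/
def re (ξ : Bicomplex) : ℝ := ξ.z₁.re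

/-- For `ξ = x₀ + i₁ x₁ + i₂ x₂ + j x₃` with `j = i₁ i₂`, the hyperbolic part `x₃`. -/
def imJ (ξ : Bicomplex) : ℝ := ξ.z₂.im

/-- Hyperbolic numbers `x₀ + j x₃`. -/
def IsHyperbolic (ξ : Bicomplex) : Prop := ξ.z₁.im = 0 ∧ ξ.z₂.re = 0

/-- The first idempotent component `ξ₁ = z₁ - i₁ z₂`. -/
def P₁ : Bicomplex →+* ℂ where
  toFun ξ := ξ.z₁ - Complex.I * ξ.z₂
  map_zero' := by simp
  map_one' := by simp
  map_add' a b := by simp; ring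
  map_mul' a b := by
    simp only [mul_z₁, mul_z₂]
    linear_combination (-a.z₂ * b.z₂) * Complex.I_sq

/-- The second idempotent component `ξ₂ = z₁ + i₁ z₂`. -/
def P₂ : Bicomplex →+* ℂ where
  toFun ξ := ξ.z₁ + Complex.I * ξ.z₂
  map_zero' := by simp
  map_one' := by simp
  map_add' a b := by simp; ring
  map_mul' a b := by
    simp only [mul_z₁, mul_z₂]
    linear_combination (-a.z₂ * b.z₂) * Complex.I_sq

/-- The embedding of `ℂ = ℂ(i₁)`. -/
def ofComplex (z : ℂ) : Bicomplex := ⟨z, 0⟩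

/-- The idempotent `e₁ = (1 + i₁ i₂) / 2`. -/
def e₁ : Bicomplex := ⟨1 / 2, Complex.I / 2⟩

/-- The idempotent `e₂ = (1 - i₁ i₂) / 2`. -/
def e₂ : Bicomplex := ⟨1 / 2, -Complex.I / 2⟩

/-- The bicomplex number `a e₁ + b e₂`. -/
def ofIdem (a b : ℂ) : Bicomplex := ofComplex a * e₁ + ofComplex b * e₂

@[simp] theorem P₁_ofIdem (a b : ℂ) : P₁ (ofIdem a b) = a := by
  simp only [P₁, ofIdem, ofComplex, e₁, e₂, RingHom.coe_mk, MonoidHom.coe_mk, OneHom.coe_mk,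
    add_z₁, add_z₂, mul_z₁, mul_z₂]
  linear_combination (-a / 2 + b / 2) * Complex.I_sq

@[simp] theorem P₂_ofIdem (a b : ℂ) : P₂ (ofIdem a b) = b := by
  simp only [P₂, ofIdem, ofComplex, e₁, e₂, RingHom.coe_mk, MonoidHom.coe_mk, OneHom.coe_mk,
    add_z₁, add_z₂, mul_z₁, mul_z₂]
  linear_combination (a / 2 - b / 2) * Complex.I_sq

/-- The idempotent representation `ξ = ξ₁ e₁ + ξ₂ e₂`. -/
theorem ofIdem_P₁_P₂ (ξ : Bicomplex) : ofIdem (P₁ ξ) (P₂ ξ) = ξ := by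
  ext
  · simp [P₁, P₂, ofIdem, ofComplex, e₁, e₂]
    ring
  · simp only [P₁, P₂, ofIdem, ofComplex, e₁, e₂, RingHom.coe_mk, MonoidHom.coe_mk,
      OneHom.coe_mk, add_z₂, mul_z₂]
    linear_combination (-ξ.z₂) * Complex.I_sq

theorem ext_P {ξ η : Bicomplex} (h₁ : P₁ ξ = P₁ η) (h₂ : P₂ ξ = P₂ η) : ξ = η := by
  rw [← ofIdem_P₁_P₂ ξ, ← ofIdem_P₁_P₂ η, h₁, h₂]

/-- The componentwise inverse. It is the ring inverse wherever that exists, see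
`mul_inv_cancel_of_ne`. -/
instance : Inv Bicomplex := ⟨fun ξ => ofIdem (P₁ ξ)⁻¹ (P₂ ξ)⁻¹⟩

instance : Div Bicomplex := ⟨fun ξ η => ξ * η⁻¹⟩

theorem mul_inv_cancel_of_ne {ξ : Bicomplex} (h₁ : P₁ ξ ≠ 0) (h₂ : P₂ ξ ≠ 0) : ξ * ξ⁻¹ = 1 := by
  have h : ξ⁻¹ = ofIdem (P₁ ξ)⁻¹ (P₂ ξ)⁻¹ := rfl
  rw [h]
  apply ext_P <;> simp [h₁, h₂]

/-! ### Elementary and special functions, componentwise in the idempotent representation -/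

/-- The embedding of the reals. -/
def ofReal (t : ℝ) : Bicomplex := ofComplex (t : ℂ)

/-- The bicomplex exponential. -/
def exp (ξ : Bicomplex) : Bicomplex := ofIdem (Complex.exp (P₁ ξ)) (Complex.exp (P₂ ξ))

/-- Bicomplex powers `ξ ^ η`, with principal branches in both components. -/
instance : Pow Bicomplex Bicomplex := ⟨fun ξ η => ofIdem (P₁ ξ ^ P₁ η) (P₂ ξ ^ P₂ η)⟩

/-- The bicomplex Gamma function. -/
def Gamma₂ (ξ : Bicomplex) : Bicomplex := ofIdem (Complex.Gamma (P₁ ξ)) (Complex.Gamma (P₂ ξ))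

/-- The sum of a series of bicomplex numbers (convergence is convergence of both components). -/
def bcTsum (a : ℕ → Bicomplex) : Bicomplex := ofIdem (∑' u, P₁ (a u)) (∑' u, P₂ (a u))

/-- The integral of a bicomplex-valued function over a set of real numbers. -/
def bcIntegral (s : Set ℝ) (f : ℝ → Bicomplex) : Bicomplex :=
  ofIdem (∫ t in s, P₁ (f t)) (∫ t in s, P₂ (f t))

/-- The bicomplex Prabhakar (three-parameter Mittag-Leffler) function
`𝔼 ^ l _ {m, n} (ζ) = ∑ (l)_u / (u! Γ₂ (m u + n)) ζ ^ u`; here `(l)_u` is the rising factorial,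
and `1 / Γ₂` has component `0` where the Gamma function has a pole. -/
def prabhakarE (m n l ζ : Bicomplex) : Bicomplex :=
  bcTsum fun u : ℕ =>
    (ascPochhammer Bicomplex u).eval l / ((u.factorial : Bicomplex) * Gamma₂ (m * (u : Bicomplex) + n))
      * ζ ^ u

/-- The Prabhakar kernel `t ^ (n - 1) 𝔼 ^ l _ {m, n} (r t ^ m)`. -/
def prabhakarKernel (m n r l : Bicomplex) (t : ℝ) : Bicomplex :=
  ofReal t ^ (n - 1) * prabhakarE m n l (r * ofReal t ^ m)

/-! ### Convolution, Prabhakar integral, regularized Prabhakar derivative -/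

/-- The convolution `(f * g)(t) = ∫₀ᵗ f (t - s) g s ds`. -/
def conv (f g : ℝ → Bicomplex) (t : ℝ) : Bicomplex :=
  bcIntegral (Ioo 0 t) fun s => f (t - s) * g s

/-- The Prabhakar integral with lower limit `0`: convolution with the Prabhakar kernel.
In a component where the order `n` is `0`, the term `u = 0` of the kernel is
`t ^ (-1) / Γ(0)`, i.e. the limit as `n → 0+` of `t ^ (n - 1) / Γ(n)`, which is the Dirac mass
at `0`; there the operator is the identity plus convolution with the remaining series (for `l = 0`
this is the Riemann-Liouville integral of order `0`, the identity). -/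
def prabhakarIntegral (m n r l : Bicomplex) (φ : ℝ → Bicomplex) (t : ℝ) : Bicomplex :=
  ofIdem (if P₁ n = 0 then 1 else 0) (if P₂ n = 0 then 1 else 0) * φ t
    + conv (prabhakarKernel m n r l) φ t

/-- The integer `⌈Re n₁⌉`. -/
def ord₁ (n : Bicomplex) : ℕ := ⌈(P₁ n).re⌉₊

/-- The integer `⌈Re n₂⌉`. -/
def ord₂ (n : Bicomplex) : ℕ := ⌈(P₂ n).re⌉₊

/-- `⌈n⌉ = ⌈Re n₁⌉ e₁ + ⌈Re n₂⌉ e₂`. -/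
def bceil (n : Bicomplex) : Bicomplex := ofIdem (ord₁ n : ℂ) (ord₂ n : ℂ)

/-- `d ^ k f / dt ^ k` for `k = ⌈n⌉`, i.e. `f₁` is differentiated `⌈Re n₁⌉` times and `f₂` is
differentiated `⌈Re n₂⌉` times. -/
def derivCeil (n : Bicomplex) (f : ℝ → Bicomplex) (t : ℝ) : Bicomplex :=
  ofIdem (iteratedDeriv (ord₁ n) (fun s => P₁ (f s)) t)
    (iteratedDeriv (ord₂ n) (fun s => P₂ (f s)) t)

/-- The regularized (Caputo type) Prabhakar derivative with lower limit `0`,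
`𝔼 ^ (-l) _ {m, k - n, r, 0+} (d ^ k f / dt ^ k)` with `k = ⌈n⌉`. -/
def regPrabhakarDeriv (m n r l : Bicomplex) (f : ℝ → Bicomplex) : ℝ → Bicomplex :=
  prabhakarIntegral m (bceil n - n) r (-l) (derivCeil n f)

/-! ### Function classes -/

/-- `φ ∈ AC ^ M (0, b)` for every `b > 0` (used for `M ≥ 1`): `φ` has continuous derivatives up to
order `M - 1` on `(0, ∞)`, and the derivative of order `M - 1` is absolutely continuous on
`(0, b)`, i.e. extends to an absolutely continuous function on `[0, b]`. -/
def ACLoc (M : ℕ) (φ : ℝ → ℂ) : Prop :=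
  ContDiffOn ℝ ((M - 1 : ℕ) : ℕ∞) φ (Ioi 0) ∧
    ∀ b : ℝ, 0 < b → ∃ F : ℝ → ℂ, AbsolutelyContinuousOnInterval F 0 b ∧
      EqOn F (iteratedDeriv (M - 1) φ) (Ioo 0 b)

/-- A complex function on `(0, ∞)` that is Lebesgue integrable on `(0, b)` for all `b > 0` and of
exponential order. -/
def ExpClassC (φ : ℝ → ℂ) : Prop :=
  (∀ b : ℝ, 0 < b → IntegrableOn φ (Ioo 0 b)) ∧
    ∃ C M T : ℝ, ∀ᵐ t : ℝ, T ≤ t → ‖φ t‖ ≤ C * Real.exp (M * t)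

/-- Bicomplex functions on `(0, ∞)` that are integrable on bounded intervals and of exponential
order. -/
def ExpClass (f : ℝ → Bicomplex) : Prop :=
  ExpClassC (fun t => P₁ (f t)) ∧ ExpClassC (fun t => P₂ (f t))

/-! ### Laplace transform -/

/-- The bicomplex Laplace transform `∫₀^∞ f t exp (-ξ t) dt`. -/
def laplace (f : ℝ → Bicomplex) (ξ : Bicomplex) : Bicomplex :=
  bcIntegral (Ioi 0) fun t => f t * exp (-ξ * ofReal t)

/-- `h = ℒ⁻¹ {F}`: `h` is locally integrable and of exponential order, and its Laplace transform is
`F` on some domain `Re ξ > M + |Im_j ξ|`. Such an `h` is unique up to null sets. -/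
def IsInvLaplace (F : Bicomplex → Bicomplex) (h : ℝ → Bicomplex) : Prop :=
  ExpClass h ∧ ∃ M : ℝ, ∀ ξ : Bicomplex, M + |ξ.imJ| < ξ.re → laplace h ξ = F ξ

/-- `ξ ^ n (1 - r ξ ^ (-m)) ^ l`. -/
def symb (m n r l ξ : Bicomplex) : Bicomplex := ξ ^ n * (1 - r * ξ ^ (-m)) ^ l

end Bicomplex

end

open Bicomplex

/-!
The idempotent components `P₁`, `P₂` are ring homomorphisms that commute with every operation in
the statement, and `Re ξ > M + |Im_j ξ|` says that both components lie in the half-plane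
`Re z > M`. So everything is a statement about complex functions, for orders in the right
half-plane.

Write `S z = z ^ n (1 - r z ^ (-m)) ^ l`. The transform of the Prabhakar kernel is `1 / S` and that
of the kernel in the derivative, Dirac mass included when `n = k`, is
`z ^ (n - k) (1 - r z ^ (-m)) ^ l`. The equation cannot be transformed directly, since `f ^ (k)` is
not assumed to be of exponential order. But on `(0, b)` only its truncation to `(0, b)` enters.
Convolving with the Prabhakar kernel multiplies the two symbols to `z ^ (-k)`, the symbol of
`k`-fold integration, so injectivity of the Laplace transform (`ae_eq_of_lap_eq`) and the repeated
fundamental theorem of calculus (`exists_iterated_integral`) give the Volterra equation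
`f - τ₀ = e * (g - κ f)` with the Prabhakar kernel `e` (`volterra_of_regPrabhakar`). All its terms
have Laplace transforms; solving `F - τ₀ / z = (G - κ F) / S` for `F` and inverting again gives the
formula (`solution_formula`). For `κ = 0` the Volterra equation is already the formula.

The inverse transforms exist because `1 / (S + κ)` and `(S / z) / (S + κ)` expand, far to the right,
into absolutely convergent double series of powers `z ^ (-a)` (`exists_invLap_resolvent`), which are
inverted termwise to `∑ d t ^ (a - 1) / Γ(a)`. The exponents `a` are complex and lie in a sector
around the positive axis. There `|Γ(a)|` is at least `Γ(Re a)` up to an exponential factor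
(`Gamma_re_le_norm_Gamma`, from Euler's limit formula), which makes the inverted series converge
to a function of exponential order (`Admissible.expClassC`, `Admissible.hasSum_lap`).
-/

noncomputable section

/-! ### The Laplace transform of complex functions on the half-line -/

namespace LaplaceC

/-- The Laplace transform of a complex function on the half-line. -/
def lap (φ : ℝ → ℂ) (z : ℂ) : ℂ := ∫ t in Ioi (0 : ℝ), φ t * Complex.exp (-z * t)

/-- `φ t * exp (-c t)` is integrable on `(0, ∞)`, so that the Laplace integral of `φ` converges
absolutely for `c ≤ Re z`. Unlike exponential order this passes to convolutions at no cost. -/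
def LapInt (φ : ℝ → ℂ) (c : ℝ) : Prop :=
  IntegrableOn (fun t : ℝ => φ t * Complex.exp (-(c : ℂ) * t)) (Ioi 0)

/-- One-sided convolution on `(0, ∞)`. -/
def cconv (φ ψ : ℝ → ℂ) (t : ℝ) : ℂ := ∫ s in Ioo 0 t, φ (t - s) * ψ s

variable {φ ψ : ℝ → ℂ} {c : ℝ}

theorem LapInt.integrableOn (h : LapInt φ c) {z : ℂ} (hz : c ≤ z.re) :
    IntegrableOn (fun t : ℝ => φ t * Complex.exp (-z * t)) (Ioi 0) := by
  have h1 : IntegrableOn (fun t : ℝ => Complex.exp (-(z - c) * t) *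
      (φ t * Complex.exp (-(c : ℂ) * t))) (Ioi 0) := by
    refine Integrable.bdd_mul (c := 1) h (Continuous.aestronglyMeasurable (by fun_prop)) ?_
    refine (ae_restrict_iff' measurableSet_Ioi).2 (.of_forall fun t ht => ?_)
    rw [Complex.norm_exp]
    simp only [Complex.mul_re, Complex.neg_re, Complex.sub_re, Complex.ofReal_re, Complex.ofReal_im,
      mul_zero, sub_zero, Real.exp_le_one_iff]
    have : 0 < t := ht
    nlinarith
  refine h1.congr_fun (fun t _ => ?_) measurableSet_Ioi
  simp only
  rw [mul_left_comm, ← Complex.exp_add]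
  congr 2
  ring

theorem LapInt.mono (h : LapInt φ c) {c' : ℝ} (hc : c ≤ c') : LapInt φ c' := by
  have := h.integrableOn (z := (c' : ℂ)) (by simpa using hc)
  exact this

theorem lap_congr (he : φ =ᵐ[volume.restrict (Ioi 0)] ψ) (z : ℂ) : lap φ z = lap ψ z := by
  refine integral_congr_ae ?_
  filter_upwards [he] with t ht
  rw [ht]

theorem LapInt.add (h : LapInt φ c) (h' : LapInt ψ c) : LapInt (fun t => φ t + ψ t) c := by
  simp only [LapInt, add_mul]
  exact Integrable.add h h'

theorem LapInt.sub (h : LapInt φ c) (h' : LapInt ψ c) : LapInt (fun t => φ t - ψ t) c := by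
  simp only [LapInt, sub_mul]
  exact Integrable.sub h h'

theorem LapInt.const_mul (a : ℂ) (h : LapInt φ c) : LapInt (fun t => a * φ t) c := by
  simp only [LapInt, mul_assoc]
  exact Integrable.const_mul h a

theorem lap_add (h : LapInt φ c) (h' : LapInt ψ c) {z : ℂ} (hz : c ≤ z.re) :
    lap (fun t => φ t + ψ t) z = lap φ z + lap ψ z := by
  simp only [lap, add_mul]
  exact integral_add (h.integrableOn hz) (h'.integrableOn hz)

theorem lap_sub (h : LapInt φ c) (h' : LapInt ψ c) {z : ℂ} (hz : c ≤ z.re) :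
    lap (fun t => φ t - ψ t) z = lap φ z - lap ψ z := by
  simp only [lap, sub_mul]
  exact integral_sub (h.integrableOn hz) (h'.integrableOn hz)

theorem lap_const_mul (a : ℂ) (φ : ℝ → ℂ) (z : ℂ) : lap (fun t => a * φ t) z = a * lap φ z := by
  simp only [lap, mul_assoc]
  exact integral_const_mul _ _

/-- The function `φ t * exp (-z t)`, extended by zero to the whole line. -/
def damp (φ : ℝ → ℂ) (z : ℂ) : ℝ → ℂ :=
  (Ioi (0 : ℝ)).indicator fun t => φ t * Complex.exp (-z * t)

theorem integral_damp (φ : ℝ → ℂ) (z : ℂ) : ∫ t, damp φ z t = lap φ z :=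
  integral_indicator measurableSet_Ioi

theorem LapInt.integrable_damp (h : LapInt φ c) {z : ℂ} (hz : c ≤ z.re) : Integrable (damp φ z) :=
  (integrable_indicator_iff measurableSet_Ioi).2 (h.integrableOn hz)

/-- Damping is multiplicative for convolution, as `exp (-z t) = exp (-z s) exp (-z (t - s))`. -/
theorem convolution_damp (φ ψ : ℝ → ℂ) (z : ℂ) :
    convolution (damp ψ z) (damp φ z) (ContinuousLinearMap.mul ℝ ℂ) volume
      = damp (cconv φ ψ) z := by
  funext t
  rw [convolution_def]
  have key : ∀ s, (ContinuousLinearMap.mul ℝ ℂ) (damp ψ z s) (damp φ z (t - s)) =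
      (Ioo 0 t).indicator (fun s => φ (t - s) * ψ s * Complex.exp (-z * t)) s := by
    intro s
    simp only [damp, indicator, mem_Ioi, mem_Ioo, sub_pos, ContinuousLinearMap.mul_apply']
    by_cases h1 : 0 < s <;> by_cases h2 : s < t <;> simp only [h1, h2, if_true, if_false,
      and_self, and_true, and_false, mul_zero, zero_mul]
    have : Complex.exp (-z * t) = Complex.exp (-z * s) * Complex.exp (-z * ((t - s : ℝ) : ℂ)) := by
      rw [← Complex.exp_add]; congr 1; push_cast; ring
    rw [this]; ring
  simp_rw [key]
  rw [integral_indicator measurableSet_Ioo, integral_mul_const]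
  by_cases ht : 0 < t
  · simp [damp, cconv, ht]
  · simp [damp, ht]

theorem LapInt.cconv (h : LapInt φ c) (h' : LapInt ψ c) : LapInt (cconv φ ψ) c := by
  have hz : c ≤ (c : ℂ).re := by simp
  have := (h'.integrable_damp hz).integrable_convolution (ContinuousLinearMap.mul ℝ ℂ)
    (h.integrable_damp hz)
  rw [convolution_damp] at this
  exact (integrable_indicator_iff measurableSet_Ioi).1 this

theorem lap_cconv (h : LapInt φ c) (h' : LapInt ψ c) {z : ℂ} (hz : c ≤ z.re) :
    lap (LaplaceC.cconv φ ψ) z = lap φ z * lap ψ z := by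
  have := integral_convolution (ContinuousLinearMap.mul ℝ ℂ) (μ := volume) (ν := volume)
    (h'.integrable_damp hz) (h.integrable_damp hz)
  rw [convolution_damp] at this
  simpa [integral_damp, mul_comm] using this

open scoped FourierTransform ContDiff in
/-- An integrable function on the line with vanishing Fourier transform is zero: every test
function is the Fourier transform of a Schwartz function, and the transform is self-adjoint. -/
theorem ae_eq_zero_of_fourier_eq_zero {F : ℝ → ℂ} (hF : Integrable F)
    (h0 : ∀ w, 𝓕 F w = 0) : ∀ᵐ t, F t = 0 := by
  refine ae_eq_zero_of_integral_contDiff_smul_eq_zero hF.locallyIntegrable fun g hg hc => ?_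
  have hg₁ : HasCompactSupport (Complex.ofRealCLM ∘ g) := hc.comp_left rfl
  have hg₂ : ContDiff ℝ ∞ (Complex.ofRealCLM ∘ g) := by fun_prop
  set G : SchwartzMap ℝ ℂ := hg₁.toSchwartzMap hg₂ with hG
  obtain ⟨P, hP⟩ : ∃ P : SchwartzMap ℝ ℂ, 𝓕 P = G :=
    ⟨𝓕⁻ G, FourierTransform.fourier_fourierInv_eq G⟩
  have h := VectorFourier.integral_bilin_fourierIntegral_eq_flip (ContinuousLinearMap.mul ℂ ℂ)
    (L := innerₗ ℝ) (μ := volume) (ν := volume) Real.continuous_fourierChar continuous_inner hF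
    P.integrable
  have h2 : ∀ w, VectorFourier.fourierIntegral Real.fourierChar volume (innerₗ ℝ) F w = 0 := h0
  have h3 : ∀ w, VectorFourier.fourierIntegral Real.fourierChar volume (innerₗ ℝ).flip P w
      = G w := by
    intro w
    rw [← hP, SchwartzMap.fourier_coe, Real.fourier_eq]
    simp [VectorFourier.fourierIntegral]
  simp only [h2, h3, map_zero, _root_.zero_apply, integral_zero] at h
  rw [h]
  refine integral_congr_ae (.of_forall fun t => ?_)
  simp [hG, mul_comm]

/-- Injectivity of the Laplace transform. -/
theorem ae_eq_zero_of_lap_eq_zero (h : LapInt φ c) (h0 : ∀ z : ℂ, c ≤ z.re → lap φ z = 0) :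
    φ =ᵐ[volume.restrict (Ioi 0)] 0 := by
  have h1 := ae_eq_zero_of_fourier_eq_zero (h.integrable_damp (z := c) (by simp)) (fun w => by
    rw [Real.fourier_eq']
    have := h0 (c + 2 * Real.pi * w * Complex.I) (by simp)
    rw [← integral_damp] at this
    rw [← this]
    congr 1
    funext t
    by_cases ht : 0 < t
    · simp only [damp, indicator, mem_Ioi, ht, if_true, smul_eq_mul]
      rw [mul_left_comm, ← Complex.exp_add]
      congr 2
      simp
      ring
    · simp [damp, indicator, ht])
  rw [EventuallyEq, ae_restrict_iff' measurableSet_Ioi]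
  filter_upwards [h1] with t ht ht0
  simpa [damp, indicator, mem_Ioi.1 ht0] using ht

theorem ae_eq_of_lap_eq (h : LapInt φ c) (h' : LapInt ψ c)
    (h0 : ∀ z : ℂ, c ≤ z.re → lap φ z = lap ψ z) :
    φ =ᵐ[volume.restrict (Ioi 0)] ψ := by
  have := ae_eq_zero_of_lap_eq_zero (h.sub h') fun z hz => by
    rw [lap_sub h h' hz, h0 z hz, sub_self]
  filter_upwards [this] with t ht
  exact sub_eq_zero.1 ht

/-- A function of exponential order has an absolutely convergent Laplace integral far to the
right. -/
theorem exists_lapInt (h : ExpClassC φ) : ∃ c, LapInt φ c := by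
  obtain ⟨hi, C, M, T, hb⟩ := h
  set T' := max T 1
  have hT' : 0 < T' := lt_of_lt_of_le one_pos (le_max_right _ _)
  refine ⟨M + 1, ?_⟩
  have hcov : Ioi (0 : ℝ) ⊆ Ioo 0 (T' + 1) ∪ Ioi T' := by
    intro t ht
    by_cases h : t < T' + 1
    · exact Or.inl ⟨ht, h⟩
    · exact Or.inr (by simp only [mem_Ioi]; linarith)
  have hmeas : AEStronglyMeasurable φ (volume.restrict (Ioi 0)) := by
    have : Ioi (0 : ℝ) = ⋃ k : ℕ, Ioo 0 ((k : ℝ) + 1) := by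
      ext t
      simp only [mem_Ioi, mem_iUnion, mem_Ioo]
      refine ⟨fun ht => ?_, fun ⟨k, hk⟩ => hk.1⟩
      obtain ⟨k, hk⟩ := exists_nat_gt t
      exact ⟨k, ht, by linarith⟩
    rw [this, aestronglyMeasurable_iUnion_iff]
    exact fun k => (hi _ (by positivity)).aestronglyMeasurable
  refine IntegrableOn.mono_set (IntegrableOn.union ?_ ?_) hcov
  · obtain ⟨K, hK⟩ := (isCompact_Icc (a := (0 : ℝ)) (b := T' + 1)).exists_bound_of_continuousOn
      (f := fun t : ℝ => Complex.exp (-((M + 1 : ℝ) : ℂ) * t)) (by fun_prop)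
    refine Integrable.mul_bdd (c := K) (hi _ (by positivity))
      (Continuous.aestronglyMeasurable (by fun_prop)) ?_
    exact (ae_restrict_iff' measurableSet_Ioo).2
      (.of_forall fun t ht => hK t (Ioo_subset_Icc_self ht))
  · have hd : IntegrableOn (fun t : ℝ => |C| * Real.exp (-t)) (Ioi T') :=
      (integrableOn_exp_neg_Ioi T').const_mul _
    refine Integrable.mono' hd ?_ ?_
    · exact (hmeas.mono_measure (Measure.restrict_mono (Ioi_subset_Ioi hT'.le) le_rfl)).mul
        (Continuous.aestronglyMeasurable (by fun_prop))
    · rw [ae_restrict_iff' measurableSet_Ioi]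
      filter_upwards [hb] with t ht htT
      have h1 := ht ((le_max_left _ _).trans (mem_Ioi.1 htT).le)
      rw [norm_mul, Complex.norm_exp]
      have e : (-((M + 1 : ℝ) : ℂ) * t).re = -((M + 1) * t) := by simp; ring
      rw [e]
      calc ‖φ t‖ * Real.exp (-((M + 1) * t))
          ≤ (|C| * Real.exp (M * t)) * Real.exp (-((M + 1) * t)) := by
            gcongr
            exact h1.trans (by gcongr; exact le_abs_self C)
        _ = |C| * Real.exp (-t) := by
            rw [mul_assoc, ← Real.exp_add]; congr 2; ring

end LaplaceC

/-! ### Gamma integrals and a lower bound for the Gamma function in a sector -/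

namespace LaplaceC

theorem lapInt_cpow {a : ℂ} (ha : 0 < a.re) {c : ℝ} (hc : 0 < c) :
    LapInt (fun t : ℝ => (t : ℂ) ^ (a - 1)) c := by
  have h := integrableOn_rpow_mul_exp_neg_mul_rpow (p := 1) (s := a.re - 1) (by linarith)
    one_pos hc
  refine Integrable.mono' h ?_ ?_
  · refine ContinuousOn.aestronglyMeasurable (fun t ht => ?_) measurableSet_Ioi
    refine ContinuousAt.continuousWithinAt (ContinuousAt.mul ?_ (by fun_prop))
    exact Complex.continuousAt_ofReal_cpow_const _ _ (Or.inr (mem_Ioi.1 ht).ne')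
  · refine (ae_restrict_iff' measurableSet_Ioi).2 (.of_forall fun t ht => ?_)
    rw [norm_mul, Complex.norm_cpow_eq_rpow_re_of_pos ht, Complex.norm_exp]
    simp

theorem differentiableAt_lap {φ : ℝ → ℂ} {c : ℝ} (h : LapInt φ c) {z : ℂ} (hz : c < z.re) :
    DifferentiableAt ℂ (lap φ) z := by
  set ε := (z.re - c) / 2 with hε
  have hε0 : 0 < ε := by linarith
  have key := hasDerivAt_integral_of_dominated_loc_of_deriv_le (𝕜 := ℂ)
    (μ := volume.restrict (Ioi (0 : ℝ)))
    (F := fun z t => φ t * Complex.exp (-z * t))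
    (F' := fun z t => φ t * (Complex.exp (-z * t) * (-t)))
    (bound := fun t => ‖φ t * Complex.exp (-(c : ℂ) * t)‖ * ε⁻¹)
    (x₀ := z) (s := Metric.ball z ε) (Metric.ball_mem_nhds z hε0)
    ?_ (h.integrableOn hz.le) ?_ ?_ ?_ ?_
  · exact key.2.differentiableAt
  · have : ∀ᶠ w in 𝓝 z, c < w.re :=
      (isOpen_lt continuous_const Complex.continuous_re).mem_nhds hz
    filter_upwards [this] with w hw
    exact (h.integrableOn hw.le).aestronglyMeasurable
  · have h1 := (h.integrableOn hz.le).aestronglyMeasurable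
    have h2 : AEStronglyMeasurable (fun t : ℝ => (-t : ℂ)) (volume.restrict (Ioi 0)) :=
      Continuous.aestronglyMeasurable (by fun_prop)
    refine (h1.mul h2).congr (.of_forall fun t => ?_)
    simp only [Pi.mul_apply, mul_assoc]
  · refine (ae_restrict_iff' measurableSet_Ioi).2 (.of_forall fun t ht w hw => ?_)
    have ht0 : 0 < t := ht
    have hw1 : c + ε ≤ w.re := by
      have h1 := Complex.abs_re_le_norm (w - z)
      have h2 : ‖w - z‖ < ε := by simpa [dist_eq_norm] using hw
      have h3 := abs_le.1 (h1.trans h2.le)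
      simp only [Complex.sub_re] at h3
      linarith [h3.1]
    rw [norm_mul, norm_mul, norm_mul, mul_assoc, Complex.norm_exp, Complex.norm_exp]
    refine mul_le_mul_of_nonneg_left ?_ (norm_nonneg _)
    simp only [norm_neg, Complex.norm_real, Real.norm_eq_abs, abs_of_pos ht0]
    have e1 : (-w * (t : ℂ)).re = -(w.re * t) := by simp
    have e2 : (-(c : ℂ) * (t : ℂ)).re = -(c * t) := by simp
    rw [e1, e2]
    -- `t ≤ exp (ε t) / ε` absorbs the factor produced by differentiation
    have h4 : t ≤ Real.exp (ε * t) * ε⁻¹ := by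
      rw [← div_eq_mul_inv, le_div_iff₀ hε0]
      linarith [Real.add_one_le_exp (ε * t)]
    calc Real.exp (-(w.re * t)) * t
        ≤ Real.exp (-((c + ε) * t)) * (Real.exp (ε * t) * ε⁻¹) := by
          gcongr
      _ = Real.exp (-(c * t)) * ε⁻¹ := by
          rw [← mul_assoc, ← Real.exp_add]; congr 2; ring
  · exact h.norm.mul_const _
  · refine .of_forall fun t w _ => ?_
    have h1 : HasDerivAt (fun w : ℂ => -w * (t : ℂ)) (-t) w := by
      simpa using (hasDerivAt_id w).neg.mul_const (t : ℂ)
    exact (h1.cexp).const_mul (φ t)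

/-- The Laplace transform of a complex power, for complex argument: it is known for positive
arguments, and both sides are holomorphic in the right half-plane. -/
theorem lap_cpow {a : ℂ} (ha : 0 < a.re) {z : ℂ} (hz : 0 < z.re) :
    lap (fun t : ℝ => (t : ℂ) ^ (a - 1)) z = Complex.Gamma a * z ^ (-a) := by
  have hU : IsOpen {z : ℂ | 0 < z.re} := isOpen_lt continuous_const Complex.continuous_re
  have hconv : IsPreconnected {z : ℂ | 0 < z.re} :=
    (convex_halfSpace_re_gt 0).isPreconnected
  have h1 : AnalyticOnNhd ℂ (lap (fun t : ℝ => (t : ℂ) ^ (a - 1))) {z : ℂ | 0 < z.re} :=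
    DifferentiableOn.analyticOnNhd (fun w hw => by
      have hw' : 0 < w.re := hw
      exact (differentiableAt_lap (lapInt_cpow ha (half_pos hw'))
        (half_lt_self hw')).differentiableWithinAt) hU
  have h2 : AnalyticOnNhd ℂ (fun z : ℂ => Complex.Gamma a * z ^ (-a)) {z : ℂ | 0 < z.re} :=
    DifferentiableOn.analyticOnNhd (fun w hw => by
      have hw' : w ∈ Complex.slitPlane := Or.inl hw
      exact ((differentiableAt_id.cpow_const hw').const_mul _).differentiableWithinAt) hU
  have hreal : ∀ x : ℝ, 0 < x →
      lap (fun t : ℝ => (t : ℂ) ^ (a - 1)) x = Complex.Gamma a * (x : ℂ) ^ (-a) := by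
    intro x hx
    have := Complex.integral_cpow_mul_exp_neg_mul_Ioi ha hx
    simp only [lap, neg_mul]
    rw [this, one_div, Complex.inv_cpow _ _
      (by rw [Complex.arg_ofReal_of_nonneg hx.le]; exact Real.pi_pos.ne),
      Complex.cpow_neg, mul_comm]
  refine h1.eqOn_of_preconnected_of_frequently_eq h2 hconv (z₀ := 1) (by simp) ?_ hz
  -- positive arguments other than `1` accumulate at `1`
  have htend : Tendsto (fun k : ℕ => ((1 + 1 / ((k : ℝ) + 1) : ℝ) : ℂ)) atTop (𝓝[≠] 1) := by
    refine tendsto_nhdsWithin_iff.2 ⟨?_, .of_forall fun k => ?_⟩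
    · have := (tendsto_one_div_add_atTop_nhds_zero_nat (𝕜 := ℝ)).const_add 1
      rw [add_zero] at this
      exact_mod_cast (Complex.continuous_ofReal.tendsto _).comp this
    · have : (0 : ℝ) < 1 / ((k : ℝ) + 1) := by positivity
      simp only [mem_compl_iff, mem_singleton_iff]
      rw [← Complex.ofReal_one, Complex.ofReal_inj]
      linarith
  exact htend.frequently (Frequently.of_forall fun k => hreal _ (by positivity))

/-- The product in Euler's limit formula, compared with the product for the real part. -/
theorem prod_norm_sq_le (a : ℂ) (ha : 0 < a.re) (N : ℕ) :
    ∏ j ∈ Finset.range (N + 1), ‖a + j‖ ^ 2 ≤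
      (∏ j ∈ Finset.range (N + 1), (a.re + j) ^ 2) *
        Real.exp (a.im ^ 2 / a.re ^ 2 + a.im ^ 2 * (1 / a.re - 1 / (a.re + N))) := by
  have hf : ∀ j : ℕ, ‖a + j‖ ^ 2 ≤ (a.re + j) ^ 2 * Real.exp (a.im ^ 2 / (a.re + j) ^ 2) := by
    intro j
    have hp : 0 < a.re + j := by positivity
    have e : ‖a + j‖ ^ 2 = (a.re + j) ^ 2 + a.im ^ 2 := by
      rw [← Complex.normSq_eq_norm_sq, Complex.normSq_apply]; simp; ring
    rw [e]
    have := Real.add_one_le_exp (a.im ^ 2 / (a.re + j) ^ 2)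
    calc (a.re + j) ^ 2 + a.im ^ 2 = (a.re + j) ^ 2 * (a.im ^ 2 / (a.re + j) ^ 2 + 1) := by
          field_simp; ring
      _ ≤ _ := by gcongr
  induction N with
  | zero => simpa using hf 0
  | succ N ih =>
    rw [Finset.prod_range_succ]
    calc _ ≤ ((∏ j ∈ Finset.range (N + 1), (a.re + j) ^ 2) *
        Real.exp (a.im ^ 2 / a.re ^ 2 + a.im ^ 2 * (1 / a.re - 1 / (a.re + N)))) *
        ((a.re + (N + 1 : ℕ)) ^ 2 * Real.exp (a.im ^ 2 / (a.re + (N + 1 : ℕ)) ^ 2)) :=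
          mul_le_mul ih (hf _) (by positivity) (by positivity)
      _ = ((∏ j ∈ Finset.range (N + 1), (a.re + j) ^ 2) * (a.re + (N + 1 : ℕ)) ^ 2) *
        Real.exp (a.im ^ 2 / a.re ^ 2 + a.im ^ 2 * (1 / a.re - 1 / (a.re + N)) +
          a.im ^ 2 / (a.re + (N + 1 : ℕ)) ^ 2) := by rw [Real.exp_add _ (_ / _)]; ring
      _ ≤ _ := by
        -- telescoping: `1 / (x + N + 1) ^ 2 ≤ 1 / (x + N) - 1 / (x + N + 1)`
        have h1 : 0 < a.re + N := by positivity
        have h2 : 1 / (a.re + (N + 1 : ℕ)) ^ 2 ≤ 1 / (a.re + N) - 1 / (a.re + (N + 1 : ℕ)) := by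
          push_cast
          rw [div_sub_div _ _ (by positivity) (by positivity),
            div_le_div_iff₀ (by positivity) (by positivity)]
          nlinarith
        have h3 : a.im ^ 2 / (a.re + (N + 1 : ℕ)) ^ 2
            ≤ a.im ^ 2 * (1 / (a.re + N) - 1 / (a.re + (N + 1 : ℕ))) := by
          rw [div_eq_mul_one_div]; gcongr
        rw [Finset.prod_range_succ (n := N + 1)]
        refine mul_le_mul_of_nonneg_left (Real.exp_le_exp.2 ?_) (by positivity)
        linarith

/-- In the sector `|Im a| ≤ K Re a` the modulus of the Gamma function is smaller than its value at
the real part by an at most exponential factor. -/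
theorem Gamma_re_le_norm_Gamma {a : ℂ} (ha : 0 < a.re) {K : ℝ} (hK : |a.im| ≤ K * a.re) :
    Real.Gamma a.re ≤ ‖Complex.Gamma a‖ * Real.exp (K ^ 2 / 2 + K ^ 2 / 2 * a.re) := by
  have h1 := Real.GammaSeq_tendsto_Gamma a.re
  have h2 := (Complex.GammaSeq_tendsto_Gamma a).norm.mul_const
    (Real.exp (K ^ 2 / 2 + K ^ 2 / 2 * a.re))
  refine le_of_tendsto_of_tendsto h1 h2 ?_
  filter_upwards [eventually_gt_atTop 0] with N hN
  have hsq : a.im ^ 2 ≤ K ^ 2 * a.re ^ 2 := by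
    rw [← sq_abs a.im, ← mul_pow]
    gcongr
  have hp := prod_norm_sq_le a ha N
  have hexp : a.im ^ 2 / a.re ^ 2 + a.im ^ 2 * (1 / a.re - 1 / (a.re + N))
      ≤ 2 * (K ^ 2 / 2 + K ^ 2 / 2 * a.re) := by
    have e1 : a.im ^ 2 / a.re ^ 2 ≤ K ^ 2 := by rwa [div_le_iff₀ (by positivity)]
    have e2 : a.im ^ 2 * (1 / a.re - 1 / (a.re + N)) ≤ K ^ 2 * a.re := by
      have : 0 < 1 / (a.re + N) := by positivity
      calc a.im ^ 2 * (1 / a.re - 1 / (a.re + N)) ≤ a.im ^ 2 * (1 / a.re) := by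
            gcongr; linarith
        _ ≤ K ^ 2 * a.re ^ 2 * (1 / a.re) := by gcongr
        _ = K ^ 2 * a.re := by field_simp
    linarith
  rw [Finset.prod_pow, Finset.prod_pow] at hp
  have hP : ∏ j ∈ Finset.range (N + 1), ‖a + j‖ ≤
      (∏ j ∈ Finset.range (N + 1), (a.re + j)) * Real.exp (K ^ 2 / 2 + K ^ 2 / 2 * a.re) := by
    refine le_of_sq_le_sq ?_ (by positivity)
    rw [mul_pow, ← Real.exp_nat_mul]
    refine hp.trans ?_
    gcongr
    exact_mod_cast hexp
  have hpos : 0 < ∏ j ∈ Finset.range (N + 1), ‖a + j‖ := by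
    refine Finset.prod_pos fun j _ => norm_pos_iff.2 fun h => ?_
    have := congrArg Complex.re h
    simp only [Complex.add_re, Complex.natCast_re, Complex.zero_re] at this
    have : (0 : ℝ) ≤ j := by positivity
    linarith
  have hN' : (0 : ℝ) < N := by exact_mod_cast hN
  rw [Real.GammaSeq, Complex.GammaSeq, norm_div, norm_mul, norm_prod,
    Complex.norm_natCast_cpow_of_pos hN, Complex.norm_natCast, div_mul_eq_mul_div,
    div_le_div_iff₀ (by positivity) hpos]
  calc _ ≤ ((N : ℝ) ^ a.re * N.factorial) *
      ((∏ j ∈ Finset.range (N + 1), (a.re + j)) * Real.exp (K ^ 2 / 2 + K ^ 2 / 2 * a.re)) := by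
        gcongr
    _ = _ := by ring

/-- Restricting the Gamma integral to `(t, t + 1)` bounds `t ^ x / Γ (x + 1)` by `exp (t + 1)`. -/
theorem rpow_le_Gamma_mul_exp {x t : ℝ} (hx : 0 ≤ x) (ht : 0 ≤ t) :
    t ^ x ≤ Real.Gamma (x + 1) * Real.exp (t + 1) := by
  rw [Real.Gamma_eq_integral (by linarith), ← div_le_iff₀ (Real.exp_pos _), div_eq_mul_inv,
    ← Real.exp_neg]
  have hi := Real.GammaIntegral_convergent (s := x + 1) (by linarith)
  have hsub : Ioo t (t + 1) ⊆ Ioi 0 := fun s hs => lt_of_le_of_lt ht hs.1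
  calc t ^ x * Real.exp (-(t + 1))
      = ∫ s in Ioo t (t + 1), t ^ x * Real.exp (-(t + 1)) := by simp
    _ ≤ ∫ s in Ioo t (t + 1), Real.exp (-s) * s ^ (x + 1 - 1) := by
        refine setIntegral_mono_on (integrableOn_const (by simp)) (hi.mono_set hsub)
          measurableSet_Ioo fun s hs => ?_
        rw [mul_comm, add_sub_cancel_right]
        gcongr
        · exact hs.2.le
        · exact hs.1.le
    _ ≤ _ := by
        refine setIntegral_mono_set hi ?_ hsub.eventuallyLE
        refine (ae_restrict_iff' measurableSet_Ioi).2 (.of_forall fun s hs => ?_)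
        have : 0 < s := hs
        positivity

end LaplaceC

/-! ### Series of complex powers and their Laplace transforms -/

namespace LaplaceC

theorem LapInt.integrableOn_Ioo {φ : ℝ → ℂ} {c : ℝ} (h : LapInt φ c) (b : ℝ) :
    IntegrableOn φ (Ioo 0 b) := by
  have h1 : IntegrableOn (fun t : ℝ => Complex.exp ((c : ℂ) * t) *
      (φ t * Complex.exp (-(c : ℂ) * t))) (Ioo 0 b) := by
    obtain ⟨B, hB⟩ := (isCompact_Icc (a := (0 : ℝ)) (b := b)).exists_bound_of_continuousOn
      (f := fun t : ℝ => Complex.exp ((c : ℂ) * t)) (by fun_prop)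
    refine Integrable.bdd_mul (c := B) (h.mono_set Ioo_subset_Ioi_self)
      (Continuous.aestronglyMeasurable (by fun_prop)) ?_
    exact (ae_restrict_iff' measurableSet_Ioo).2
      (.of_forall fun t ht => hB t (Ioo_subset_Icc_self ht))
  refine h1.congr_fun (fun t _ => ?_) measurableSet_Ioo
  simp only
  rw [mul_left_comm, ← Complex.exp_add]
  simp

theorem integrable_tsum_of_summable_integral_norm {ι α : Type*} [Countable ι] [MeasurableSpace α]
    {μ : Measure α} {F : ι → α → ℂ} (hF : ∀ i, Integrable (F i) μ)
    (hs : Summable fun i => ∫ x, ‖F i x‖ ∂μ) (hp : ∀ᵐ x ∂μ, Summable fun i => ‖F i x‖) :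
    Integrable (fun x => ∑' i, F i x) μ := by
  refine ⟨aestronglyMeasurable_of_tendsto_ae (atTop : Filter (Finset ι))
    (f := fun s x => ∑ i ∈ s, F i x)
    (fun s => Finset.aestronglyMeasurable_fun_sum s fun i _ => (hF i).1) ?_, ?_⟩
  · filter_upwards [hp] with x hx
    exact hx.of_norm.hasSum
  · calc ∫⁻ x, ‖∑' i, F i x‖ₑ ∂μ ≤ ∫⁻ x, ∑' i, ‖F i x‖ₑ ∂μ := by
          refine lintegral_mono_ae ?_
          filter_upwards [hp] with x hx
          have h1 := norm_tsum_le_tsum_norm hx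
          rw [← ofReal_norm]
          refine (ENNReal.ofReal_le_ofReal h1).trans ?_
          rw [ENNReal.ofReal_tsum_of_nonneg (fun _ => norm_nonneg _) hx]
          simp only [ofReal_norm, le_refl]
      _ = ∑' i, ∫⁻ x, ‖F i x‖ₑ ∂μ := lintegral_tsum fun i => (hF i).1.enorm
      _ = ∑' i, ENNReal.ofReal (∫ x, ‖F i x‖ ∂μ) := by
          congr 1; funext i; rw [ofReal_integral_norm_eq_lintegral_enorm (hF i)]
      _ = ENNReal.ofReal (∑' i, ∫ x, ‖F i x‖ ∂μ) :=
          (ENNReal.ofReal_tsum_of_nonneg (fun i => integral_nonneg fun _ => norm_nonneg _) hs).symm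
      _ < ⊤ := ENNReal.ofReal_lt_top

variable {ι : Type*}

/-- The series `∑ dᵢ t ^ (aᵢ - 1) / Γ(aᵢ)`, whose formal Laplace transform is `∑ dᵢ z ^ (-aᵢ)`. -/
def gammaSeries (a d : ι → ℂ) (t : ℝ) : ℂ :=
  ∑' i, d i / Complex.Gamma (a i) * (t : ℂ) ^ (a i - 1)

/-- Exponents in a sector `|Im a| ≤ K Re a` of the right half-plane and coefficients for which
`∑ |dᵢ| R ^ (-Re aᵢ)` converges. -/
structure Admissible (a d : ι → ℂ) (K R : ℝ) : Prop where
  re_pos : ∀ i, 0 < (a i).re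
  sector : ∀ i, |(a i).im| ≤ K * (a i).re
  pos : 0 < R
  summable : Summable fun i => ‖d i‖ * R ^ (-(a i).re)

variable {a d : ι → ℂ} {K R : ℝ}

/-- An abscissa to the right of which the Laplace integral of the series converges absolutely;
the factor beyond `R` compensates the Gamma function bound in the sector. -/
def absc (K R : ℝ) : ℝ := R * Real.exp (1 + K ^ 2 / 2)

theorem absc_pos (hR : 0 < R) : 0 < absc K R := mul_pos hR (Real.exp_pos _)

/-- The main estimate: it bounds both the norm integrals and the pointwise values of the terms. -/
theorem Admissible.weight_le (h : Admissible a d K R) (i : ι) :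
    ‖d i‖ / ‖Complex.Gamma (a i)‖ * (Real.Gamma (a i).re * Real.exp (a i).re *
      absc K R ^ (-(a i).re)) ≤ Real.exp (K ^ 2 / 2) * (‖d i‖ * R ^ (-(a i).re)) := by
  have hΓ : 0 < ‖Complex.Gamma (a i)‖ :=
    norm_pos_iff.2 (Complex.Gamma_ne_zero_of_re_pos (h.re_pos i))
  have h1 := Gamma_re_le_norm_Gamma (h.re_pos i) (h.sector i)
  have h2 : absc K R ^ (-(a i).re) =
      R ^ (-(a i).re) * Real.exp (-((1 + K ^ 2 / 2) * (a i).re)) := by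
    rw [absc, Real.mul_rpow h.pos.le (Real.exp_pos _).le, ← Real.exp_mul]
    congr 2; ring
  rw [h2, div_mul_eq_mul_div, div_le_iff₀ hΓ]
  have hR := Real.rpow_pos_of_pos h.pos (-(a i).re)
  calc ‖d i‖ * (Real.Gamma (a i).re * Real.exp (a i).re *
        (R ^ (-(a i).re) * Real.exp (-((1 + K ^ 2 / 2) * (a i).re))))
      ≤ ‖d i‖ * ((‖Complex.Gamma (a i)‖ * Real.exp (K ^ 2 / 2 + K ^ 2 / 2 * (a i).re)) *
        Real.exp (a i).re * (R ^ (-(a i).re) * Real.exp (-((1 + K ^ 2 / 2) * (a i).re)))) := by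
        gcongr
    _ = ‖d i‖ * ‖Complex.Gamma (a i)‖ * R ^ (-(a i).re) *
        (Real.exp (K ^ 2 / 2 + K ^ 2 / 2 * (a i).re) * Real.exp (a i).re *
          Real.exp (-((1 + K ^ 2 / 2) * (a i).re))) := by ring
    _ = _ := by
        rw [← Real.exp_add, ← Real.exp_add]
        have : K ^ 2 / 2 + K ^ 2 / 2 * (a i).re + (a i).re + -((1 + K ^ 2 / 2) * (a i).re)
            = K ^ 2 / 2 := by ring
        rw [this]; ring

theorem norm_term {a : ℂ} (d : ℂ) {t : ℝ} (ht : 0 < t) :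
    ‖d / Complex.Gamma a * (t : ℂ) ^ (a - 1)‖ = ‖d‖ / ‖Complex.Gamma a‖ * t ^ (a.re - 1) := by
  rw [norm_mul, norm_div, Complex.norm_cpow_eq_rpow_re_of_pos ht]
  simp

theorem Admissible.norm_term_le (h : Admissible a d K R) (i : ι) {t : ℝ} (ht : 0 < t) :
    ‖d i / Complex.Gamma (a i) * (t : ℂ) ^ (a i - 1)‖ ≤
      Real.exp (K ^ 2 / 2) * (‖d i‖ * R ^ (-(a i).re)) * (Real.exp (absc K R * t + 1) / t) := by
  set x := (a i).re with hx
  have hx0 : 0 < x := h.re_pos i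
  have hρ : 0 < absc K R := absc_pos h.pos
  rw [norm_term _ ht]
  have h1 := rpow_le_Gamma_mul_exp hx0.le (mul_pos hρ ht).le
  have h2 : t ^ (x - 1) = absc K R ^ (-x) * (absc K R * t) ^ x / t := by
    rw [Real.mul_rpow hρ.le ht.le, ← mul_assoc, ← Real.rpow_add hρ, Real.rpow_sub_one ht.ne']
    simp
  have h3 : Real.Gamma (x + 1) ≤ Real.Gamma x * Real.exp x := by
    rw [Real.Gamma_add_one hx0.ne', mul_comm]
    have := Real.Gamma_pos_of_pos hx0
    gcongr
    linarith [Real.add_one_le_exp x]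
  have hq := Real.rpow_pos_of_pos hρ (-x)
  calc ‖d i‖ / ‖Complex.Gamma (a i)‖ * t ^ (x - 1)
      ≤ ‖d i‖ / ‖Complex.Gamma (a i)‖ * (absc K R ^ (-x) *
          (Real.Gamma x * Real.exp x * Real.exp (absc K R * t + 1)) / t) := by
        rw [h2]
        gcongr
        exact h1.trans (by gcongr)
    _ = ‖d i‖ / ‖Complex.Gamma (a i)‖ * (Real.Gamma x * Real.exp x * absc K R ^ (-x)) *
          (Real.exp (absc K R * t + 1) / t) := by ring
    _ ≤ _ := by
        exact mul_le_mul_of_nonneg_right (h.weight_le i) (by positivity)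

theorem Admissible.summable_norm_term (h : Admissible a d K R) {t : ℝ} (ht : 0 < t) :
    Summable fun i => ‖d i / Complex.Gamma (a i) * (t : ℂ) ^ (a i - 1)‖ :=
  Summable.of_nonneg_of_le (fun _ => norm_nonneg _) (fun i => h.norm_term_le i ht)
    ((h.summable.mul_left _).mul_right _)

theorem Admissible.norm_gammaSeries_le (h : Admissible a d K R) {t : ℝ} (ht : 0 < t) :
    ‖gammaSeries a d t‖ ≤ Real.exp (K ^ 2 / 2) * (∑' i, ‖d i‖ * R ^ (-(a i).re)) *
      (Real.exp (absc K R * t + 1) / t) := by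
  refine (norm_tsum_le_tsum_norm (h.summable_norm_term ht)).trans ?_
  refine ((h.summable_norm_term ht).tsum_le_tsum (fun i => h.norm_term_le i ht)
    ((h.summable.mul_left _).mul_right _)).trans_eq ?_
  rw [tsum_mul_right, tsum_mul_left]

theorem Admissible.integrable_term (h : Admissible a d K R) (i : ι) {z : ℂ} (hz : 0 < z.re) :
    IntegrableOn (fun t : ℝ => d i / Complex.Gamma (a i) * (t : ℂ) ^ (a i - 1) *
      Complex.exp (-z * t)) (Ioi 0) := by
  have := (lapInt_cpow (h.re_pos i) hz).integrableOn (z := z) le_rfl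
  simp only [mul_assoc]
  exact Integrable.const_mul this _

theorem Admissible.integral_norm_term (h : Admissible a d K R) (i : ι) {z : ℂ} (hz : 0 < z.re) :
    ∫ t in Ioi (0 : ℝ), ‖d i / Complex.Gamma (a i) * (t : ℂ) ^ (a i - 1) * Complex.exp (-z * t)‖
      = ‖d i‖ / ‖Complex.Gamma (a i)‖ * (Real.Gamma (a i).re * z.re ^ (-(a i).re)) := by
  have h1 := Real.integral_rpow_mul_exp_neg_mul_Ioi (h.re_pos i) hz
  rw [one_div, Real.inv_rpow hz.le, ← Real.rpow_neg hz.le, mul_comm] at h1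
  rw [← h1, ← integral_const_mul]
  refine setIntegral_congr_fun measurableSet_Ioi fun t ht => ?_
  rw [norm_mul, norm_term _ ht, Complex.norm_exp, mul_assoc]
  simp

theorem Admissible.summable_integral_norm_term (h : Admissible a d K R) {z : ℂ}
    (hz : absc K R ≤ z.re) :
    Summable fun i => ∫ t in Ioi (0 : ℝ),
      ‖d i / Complex.Gamma (a i) * (t : ℂ) ^ (a i - 1) * Complex.exp (-z * t)‖ := by
  have hρ : 0 < absc K R := absc_pos h.pos
  refine Summable.of_nonneg_of_le (fun i => integral_nonneg fun _ => norm_nonneg _) (fun i => ?_)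
    (h.summable.mul_left (Real.exp (K ^ 2 / 2)))
  rw [h.integral_norm_term i (hρ.trans_le hz)]
  refine le_trans ?_ (h.weight_le i)
  have hx := h.re_pos i
  have hg := Real.Gamma_pos_of_pos hx
  refine mul_le_mul_of_nonneg_left ?_ (by positivity)
  refine mul_le_mul ?_ (Real.rpow_le_rpow_of_nonpos hρ hz (by linarith)) ?_ (by positivity)
  · exact le_mul_of_one_le_right hg.le (Real.one_le_exp hx.le)
  · have : 0 < z.re := hρ.trans_le hz
    positivity

theorem Admissible.lapInt [Countable ι] (h : Admissible a d K R) :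
    LapInt (gammaSeries a d) (absc K R) := by
  have hρ : 0 < absc K R := absc_pos h.pos
  simp only [LapInt, gammaSeries, ← tsum_mul_right]
  refine integrable_tsum_of_summable_integral_norm
    (fun i => h.integrable_term i (z := (absc K R : ℂ)) (by simpa using hρ))
    (h.summable_integral_norm_term (z := (absc K R : ℂ)) (by simp)) ?_
  refine (ae_restrict_iff' measurableSet_Ioi).2 (.of_forall fun t ht => ?_)
  simp only [norm_mul _ (Complex.exp _)]
  exact (h.summable_norm_term ht).mul_right _

theorem Admissible.expClassC [Countable ι] (h : Admissible a d K R) :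
    ExpClassC (gammaSeries a d) := by
  refine ⟨fun b _ => h.lapInt.integrableOn_Ioo b,
    Real.exp (K ^ 2 / 2) * (∑' i, ‖d i‖ * R ^ (-(a i).re)) * Real.exp 1, absc K R, 1,
    .of_forall fun t ht => ?_⟩
  have ht0 : 0 < t := by linarith
  have hR := h.pos
  refine (h.norm_gammaSeries_le ht0).trans ?_
  have hs : 0 ≤ ∑' i, ‖d i‖ * R ^ (-(a i).re) :=
    tsum_nonneg fun i => by positivity
  rw [mul_assoc _ (Real.exp 1), ← Real.exp_add, add_comm 1]
  refine mul_le_mul_of_nonneg_left ?_ (by positivity)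
  exact div_le_self (Real.exp_pos _).le ht

theorem Admissible.hasSum_lap [Countable ι] (h : Admissible a d K R) {z : ℂ}
    (hz : absc K R ≤ z.re) :
    HasSum (fun i => d i * z ^ (-(a i))) (lap (gammaSeries a d) z) := by
  have hz0 : 0 < z.re := (absc_pos h.pos).trans_le hz
  have h1 := hasSum_integral_of_summable_integral_norm
    (fun i => h.integrable_term i hz0) (h.summable_integral_norm_term hz)
  simp only [tsum_mul_right] at h1
  refine h1.congr_fun fun i => ?_
  have hΓ : Complex.Gamma (a i) ≠ 0 := Complex.Gamma_ne_zero_of_re_pos (h.re_pos i)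
  have := lap_cpow (h.re_pos i) hz0
  rw [lap] at this
  simp only [mul_assoc]
  rw [integral_const_mul, this]
  field_simp

end LaplaceC

/-! ### The binomial series -/

namespace LaplaceC

/-- The coefficient `(l)_u / u!` of the binomial series of `(1 - w) ^ (-l)`. -/
def pc (l : ℂ) (u : ℕ) : ℂ := (ascPochhammer ℂ u).eval l / u.factorial

/-- The coefficient `(l)_u / u!` for real `l`. -/
def rpc (l : ℝ) (u : ℕ) : ℝ := (ascPochhammer ℝ u).eval l / u.factorial

theorem pc_eq_choose (l : ℂ) (u : ℕ) : pc l u = Ring.choose (l + u - 1) u := by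
  have h : l + u - 1 - u + 1 = l := by ring
  rw [Ring.choose, h, pc, div_eq_iff (by exact_mod_cast u.factorial_ne_zero),
    ← Polynomial.ascPochhammer_smeval_eq_eval, ← Ring.factorial_nsmul_multichoose_eq_ascPochhammer,
    nsmul_eq_mul, mul_comm]

theorem rpc_eq_choose (l : ℝ) (u : ℕ) : rpc l u = Ring.choose (l + u - 1) u := by
  have h : l + u - 1 - u + 1 = l := by ring
  rw [Ring.choose, h, rpc, div_eq_iff (by exact_mod_cast u.factorial_ne_zero),
    ← Polynomial.ascPochhammer_smeval_eq_eval, ← Ring.factorial_nsmul_multichoose_eq_ascPochhammer,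
    nsmul_eq_mul, mul_comm]

theorem hasSum_pc (l : ℂ) {w : ℂ} (hw : ‖w‖ < 1) :
    HasSum (fun u => pc l u * w ^ u) ((1 - w) ^ (-l)) := by
  have h := (Complex.one_div_one_sub_cpow_hasFPowerSeriesOnBall_zero l).hasSum (y := w)
    (by simpa [Metric.mem_eball, edist_eq_enorm_sub, enorm_eq_nnnorm, ← NNReal.coe_lt_coe] using hw)
  simp only [FormalMultilinearSeries.ofScalars_apply_eq, smul_eq_mul, zero_add] at h
  rw [Complex.cpow_neg, ← one_div]
  exact h.congr_fun fun u => by rw [pc_eq_choose]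

theorem hasSum_rpc (l : ℝ) {s : ℝ} (hs0 : 0 ≤ s) (hs : s < 1) :
    HasSum (fun u => rpc l u * s ^ u) ((1 - s) ^ (-l)) := by
  have h := (Real.one_div_one_sub_rpow_hasFPowerSeriesOnBall_zero l).hasSum (y := s)
    (by simpa [Metric.mem_eball, edist_eq_enorm_sub, enorm_eq_nnnorm, ← NNReal.coe_lt_coe,
      abs_of_nonneg hs0] using hs)
  simp only [FormalMultilinearSeries.ofScalars_apply_eq, smul_eq_mul, zero_add] at h
  rw [Real.rpow_neg (by linarith), ← one_div]
  exact h.congr_fun fun u => by rw [rpc_eq_choose]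

theorem pc_succ (l : ℂ) (u : ℕ) : pc l (u + 1) = pc l u * ((l + u) / (u + 1)) := by
  simp only [pc, ascPochhammer_succ_eval, Nat.factorial_succ]
  push_cast
  field_simp

theorem rpc_succ (l : ℝ) (u : ℕ) : rpc l (u + 1) = rpc l u * ((l + u) / (u + 1)) := by
  simp only [rpc, ascPochhammer_succ_eval, Nat.factorial_succ]
  push_cast
  field_simp

theorem rpc_nonneg {l : ℝ} (hl : 0 ≤ l) (u : ℕ) : 0 ≤ rpc l u := by
  induction u with
  | zero => simp [rpc]
  | succ u ih => rw [rpc_succ]; positivity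

theorem norm_pc_le {l : ℂ} {L : ℝ} (hl : ‖l‖ ≤ L) (u : ℕ) : ‖pc l u‖ ≤ rpc L u := by
  have hL : 0 ≤ L := (norm_nonneg _).trans hl
  induction u with
  | zero => simp [rpc, pc]
  | succ u ih =>
    rw [rpc_succ, pc_succ, norm_mul, norm_div]
    have h1 : ‖l + u‖ ≤ L + u := (norm_add_le _ _).trans (by simpa using hl)
    have h2 : ‖(u : ℂ) + 1‖ = (u : ℝ) + 1 := by
      rw [← Nat.cast_add_one, Complex.norm_natCast]; push_cast; rfl
    rw [h2]
    exact mul_le_mul ih (by gcongr) (by positivity) (rpc_nonneg hL u)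

theorem exists_norm_cpow_neg_le {m : ℂ} (hm : 0 < m.re) {ε : ℝ} (hε : 0 < ε) :
    ∃ M : ℝ, 0 < M ∧ ∀ z : ℂ, M ≤ z.re → ‖z ^ (-m)‖ ≤ ε := by
  have h1 : Tendsto (fun x : ℝ => x ^ (-m.re) * Real.exp (Real.pi * |m.im|)) atTop (𝓝 0) := by
    simpa using (tendsto_rpow_neg_atTop hm).mul_const (Real.exp (Real.pi * |m.im|))
  obtain ⟨M, hM⟩ :=
    ((h1.eventually (ge_mem_nhds hε)).and (eventually_gt_atTop 0)).exists_forall_of_atTop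
  refine ⟨M, (hM M le_rfl).2, fun z hz => ?_⟩
  have hz0 : 0 < z.re := (hM M le_rfl).2.trans_le hz
  have hne : z ≠ 0 := fun h => by simp [h] at hz0
  rw [Complex.norm_cpow_of_ne_zero hne, div_eq_mul_inv, ← Real.exp_neg]
  refine le_trans ?_ (hM z.re hz).1
  have h2 : z.re ≤ ‖z‖ := (le_abs_self _).trans (Complex.abs_re_le_norm z)
  have h3 : -(z.arg * (-m).im) ≤ Real.pi * |m.im| := by
    rw [Complex.neg_im, mul_neg, neg_neg]
    refine (le_abs_self _).trans ?_
    rw [abs_mul]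
    gcongr
    exact Complex.abs_arg_le_pi z
  rw [Complex.neg_re]
  exact mul_le_mul (Real.rpow_le_rpow_of_nonpos hz0 h2 (by linarith))
    (Real.exp_le_exp.2 h3) (Real.exp_pos _).le (by positivity)

theorem exists_rpow_neg_le {m : ℂ} (hm : 0 < m.re) {ε : ℝ} (hε : 0 < ε) :
    ∃ M : ℝ, 0 < M ∧ ∀ x : ℝ, M ≤ x → x ^ (-m.re) ≤ ε := by
  obtain ⟨M, hM0, hM⟩ := exists_norm_cpow_neg_le hm hε
  refine ⟨M, hM0, fun x hx => ?_⟩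
  have := hM x (by simpa using hx)
  rwa [Complex.norm_cpow_eq_rpow_re_of_pos (hM0.trans_le hx), Complex.neg_re] at this

/-! ### The Prabhakar kernel and the resolvent series -/

/-- `φ` is an inverse Laplace transform of `F`: it is of exponential order and its transform is `F`
on some right half-plane. -/
def InvLap (F : ℂ → ℂ) (φ : ℝ → ℂ) : Prop :=
  ExpClassC φ ∧ ∃ M : ℝ, ∀ z : ℂ, M < z.re → lap φ z = F z

theorem expClassC_congr {φ ψ : ℝ → ℂ} (h : ExpClassC φ) (he : EqOn φ ψ (Ioi 0)) :
    ExpClassC ψ := by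
  obtain ⟨hi, C, M, T, hb⟩ := h
  refine ⟨fun b hb => (hi b hb).congr_fun (he.mono Ioo_subset_Ioi_self) measurableSet_Ioo,
    C, M, max T 1, ?_⟩
  filter_upwards [hb] with t ht hT
  rw [← he (show t ∈ Ioi 0 from one_pos.trans_le ((le_max_right _ _).trans hT))]
  exact ht ((le_max_left _ _).trans hT)

theorem InvLap.congr_fun {φ ψ : ℝ → ℂ} {F : ℂ → ℂ} (h : InvLap F φ) (he : EqOn φ ψ (Ioi 0)) :
    InvLap F ψ := by
  obtain ⟨h1, M, hM⟩ := h
  refine ⟨expClassC_congr h1 he, M, fun z hz => ?_⟩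
  rw [← hM z hz]
  exact (lap_congr ((ae_restrict_iff' measurableSet_Ioi).2 (.of_forall fun t ht => he ht)) z).symm

theorem InvLap.congr_transform {φ : ℝ → ℂ} {F G : ℂ → ℂ} (h : InvLap F φ) (M' : ℝ)
    (he : ∀ z : ℂ, M' < z.re → F z = G z) : InvLap G φ := by
  obtain ⟨h1, M, hM⟩ := h
  exact ⟨h1, max M M', fun z hz => by
    rw [hM z ((le_max_left _ _).trans_lt hz), he z ((le_max_right _ _).trans_lt hz)]⟩

theorem abs_im_le_ratio_mul {a : ℂ} (ha : 0 < a.re) : |a.im| ≤ |a.im| / a.re * a.re := by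
  rw [div_mul_cancel₀ _ ha.ne']

theorem cpow_neg_mul_nat_add {z : ℂ} (hz : z ≠ 0) (m b : ℂ) (u : ℕ) :
    z ^ (-(m * u + b)) = (z ^ (-m)) ^ u * z ^ (-b) := by
  rw [neg_add, Complex.cpow_add _ _ hz, ← neg_mul, Complex.cpow_mul_nat]

theorem summable_kernel_weight {m : ℂ} (l r : ℂ) (x : ℝ) {R : ℝ} (hR : 0 < R)
    (hr : ‖r‖ * R ^ (-m.re) < 1) :
    Summable fun u : ℕ => ‖pc l u * r ^ u‖ * R ^ (-(m.re * u + x)) := by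
  have h := (hasSum_rpc ‖l‖ (by positivity) hr).summable.mul_right (R ^ (-x))
  refine Summable.of_nonneg_of_le (fun _ => by positivity) (fun u => ?_) h
  rw [neg_add, Real.rpow_add hR, ← neg_mul, Real.rpow_mul hR.le, Real.rpow_natCast, norm_mul,
    norm_pow, mul_pow]
  have := norm_pc_le (le_refl ‖l‖) u
  calc _ = ‖pc l u‖ * (‖r‖ ^ u * (R ^ (-m.re)) ^ u) * R ^ (-x) := by ring
    _ ≤ _ := by gcongr

/-- The scalar Prabhakar kernel `t ^ (n - 1) ∑ (l)_u / (u! Γ(m u + n)) (r t ^ m) ^ u`. -/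
def ker (m n r l : ℂ) (t : ℝ) : ℂ :=
  (t : ℂ) ^ (n - 1) * ∑' u : ℕ, (ascPochhammer ℂ u).eval l /
    ((u.factorial : ℂ) * Complex.Gamma (m * u + n)) * (r * (t : ℂ) ^ m) ^ u

theorem ker_eq_tsum (m n r l : ℂ) {t : ℝ} (ht : 0 < t) :
    ker m n r l t =
      ∑' u : ℕ, pc l u * r ^ u / Complex.Gamma (m * u + n) * (t : ℂ) ^ (m * u + n - 1) := by
  have ht' : (t : ℂ) ≠ 0 := by exact_mod_cast ht.ne'
  rw [ker, ← tsum_mul_left]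
  congr 1
  funext u
  rw [add_sub_assoc, Complex.cpow_add _ _ ht', Complex.cpow_mul_nat, mul_pow, pc,
    div_eq_mul_inv, div_eq_mul_inv, div_eq_mul_inv, mul_inv]
  ring

theorem exists_ratio_lt_one {m : ℂ} (hm : 0 < m.re) (r : ℂ) :
    ∃ R : ℝ, 0 < R ∧ ‖r‖ * R ^ (-m.re) < 1 := by
  obtain ⟨R, hR0, hR⟩ := exists_rpow_neg_le hm (ε := 1 / (‖r‖ + 1)) (by positivity)
  refine ⟨R, hR0, ?_⟩
  calc ‖r‖ * R ^ (-m.re) ≤ ‖r‖ * (1 / (‖r‖ + 1)) := by gcongr; exact hR R le_rfl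
    _ < 1 := by
      rw [mul_one_div, div_lt_one (by positivity)]; linarith

theorem exists_norm_mul_cpow_lt_one {m : ℂ} (hm : 0 < m.re) (r : ℂ) :
    ∃ M : ℝ, 0 < M ∧ ∀ z : ℂ, M ≤ z.re → ‖r * z ^ (-m)‖ < 1 := by
  obtain ⟨M, hM0, hM⟩ := exists_norm_cpow_neg_le hm (ε := 1 / (‖r‖ + 1)) (by positivity)
  refine ⟨M, hM0, fun z hz => ?_⟩
  rw [norm_mul]
  calc ‖r‖ * ‖z ^ (-m)‖ ≤ ‖r‖ * (1 / (‖r‖ + 1)) := by gcongr; exact hM z hz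
    _ < 1 := by
      rw [mul_one_div, div_lt_one (by positivity)]; linarith

theorem invLap_ker {m n : ℂ} (hm : 0 < m.re) (hn : 0 < n.re) (r l : ℂ) :
    InvLap (fun z => z ^ (-n) * (1 - r * z ^ (-m)) ^ (-l)) (ker m n r l) := by
  obtain ⟨R, hR0, hR⟩ := exists_ratio_lt_one hm r
  obtain ⟨M, hM0, hM⟩ := exists_norm_mul_cpow_lt_one hm r
  have hA : Admissible (fun u : ℕ => m * u + n) (fun u => pc l u * r ^ u)
      (|m.im| / m.re + |n.im| / n.re) R := by
    refine ⟨fun u => ?_, fun u => ?_, hR0, ?_⟩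
    · simp only [Complex.add_re, Complex.mul_re, Complex.natCast_re, Complex.natCast_im, mul_zero,
        sub_zero]
      positivity
    · simp only [Complex.add_re, Complex.mul_re, Complex.natCast_re, Complex.natCast_im, mul_zero,
        sub_zero, Complex.add_im, Complex.mul_im, zero_add]
      have h1 := abs_im_le_ratio_mul hm
      have h2 := abs_im_le_ratio_mul hn
      calc |m.im * u + n.im| ≤ |m.im| * u + |n.im| := by
            refine (abs_add_le _ _).trans ?_
            rw [abs_mul, Nat.abs_cast]
        _ = |m.im| / m.re * m.re * u + |n.im| / n.re * n.re := by
            rw [div_mul_cancel₀ _ hm.ne', div_mul_cancel₀ _ hn.ne']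
        _ ≤ _ := by
            have : 0 ≤ |n.im| / n.re * (m.re * u) + |m.im| / m.re * n.re := by positivity
            nlinarith
    · simpa using summable_kernel_weight (m := m) l r n.re hR0 hR
  refine InvLap.congr_fun ⟨hA.expClassC, max M (absc (|m.im| / m.re + |n.im| / n.re) R),
    fun z hz => ?_⟩ fun t ht => (ker_eq_tsum m n r l ht).symm
  have hzM := (le_max_left _ _).trans hz.le
  have hz0 : z ≠ 0 := fun h => by rw [h] at hzM; simp at hzM; linarith
  refine (hA.hasSum_lap ((le_max_right _ _).trans hz.le)).unique ?_
  simp only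
  rw [mul_comm]
  refine ((hasSum_pc l (hM z hzM)).mul_right _).congr_fun fun u => ?_
  rw [cpow_neg_mul_nat_add hz0, mul_pow]
  ring

/-- For order `0` the term `u = 0` of the kernel drops out, as `1 / Γ` vanishes there, and the
transform of the remaining series lacks the constant term `1` of the binomial series. -/
theorem invLap_ker_zero {m : ℂ} (hm : 0 < m.re) (r l : ℂ) :
    InvLap (fun z => (1 - r * z ^ (-m)) ^ (-l) - 1) (ker m 0 r l) := by
  obtain ⟨R, hR0, hR⟩ := exists_ratio_lt_one hm r
  obtain ⟨M, hM0, hM⟩ := exists_norm_mul_cpow_lt_one hm r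
  have hA : Admissible (fun u : ℕ => m * (u + 1 : ℕ)) (fun u => pc l (u + 1) * r ^ (u + 1))
      (|m.im| / m.re) R := by
    refine ⟨fun u => ?_, fun u => ?_, hR0, ?_⟩
    · simp only [Complex.mul_re, Complex.natCast_re, Complex.natCast_im, mul_zero, sub_zero]
      positivity
    · simp only [Complex.mul_re, Complex.natCast_re, Complex.natCast_im, mul_zero,
        sub_zero, Complex.mul_im, zero_add, abs_mul, Nat.abs_cast]
      rw [← mul_assoc, div_mul_cancel₀ _ hm.ne']
    · have := (summable_kernel_weight (m := m) l r 0 hR0 hR).comp_injective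
        (add_left_injective 1)
      simpa [Function.comp_def] using this
  refine InvLap.congr_fun ⟨hA.expClassC, max M (absc (|m.im| / m.re) R),
    fun z hz => ?_⟩ fun t ht => ?_
  · have hzM := (le_max_left _ _).trans hz.le
    have hz0 : z ≠ 0 := fun h => by rw [h] at hzM; simp at hzM; linarith
    refine (hA.hasSum_lap ((le_max_right _ _).trans hz.le)).unique ?_
    have h1 := (hasSum_nat_add_iff' 1).2 (hasSum_pc l (hM z hzM))
    have h2 : ∑ i ∈ Finset.range 1, pc l i * (r * z ^ (-m)) ^ i = 1 := by simp [pc]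
    rw [h2] at h1
    refine h1.congr_fun fun u => ?_
    rw [← neg_mul, Complex.cpow_mul_nat, mul_pow]
    ring
  · rw [ker_eq_tsum m 0 r l ht, gammaSeries]
    have := (add_left_injective 1 : Function.Injective fun u : ℕ => u + 1).tsum_eq
      (f := fun u : ℕ => pc l u * r ^ u / Complex.Gamma (m * u + 0) *
        (t : ℂ) ^ (m * u + 0 - 1)) fun u hu => by
          rcases u with _ | u
          · simp at hu
          · exact ⟨u, rfl⟩
    rw [← this]
    simp only [add_zero]

/-- Expanding the geometric series in `c z ^ (-n) (1 - r z ^ (-m)) ^ (-l)` and then each binomial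
power gives a double series of powers of `z`, which is inverted term by term. -/
theorem exists_invLap_resolvent {m n b : ℂ} (hm : 0 < m.re) (hn : 0 < n.re) (hb : 0 < b.re)
    (r l e c : ℂ) :
    ∃ φ, InvLap (fun z => z ^ (-b) * (1 - r * z ^ (-m)) ^ (-e) /
      (1 - c * (z ^ (-n) * (1 - r * z ^ (-m)) ^ (-l)))) φ ∧
      ∃ M : ℝ, ∀ z : ℂ, M < z.re → 1 - c * (z ^ (-n) * (1 - r * z ^ (-m)) ^ (-l)) ≠ 0 := by
  -- beyond `R` the binomial ratio is at most `1 / 2`, and so is the geometric ratio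
  obtain ⟨R₁, hR₁, hR₁'⟩ := exists_rpow_neg_le hm (ε := 1 / (2 * (‖r‖ + 1))) (by positivity)
  obtain ⟨R₂, hR₂, hR₂'⟩ := exists_rpow_neg_le hn
    (ε := 1 / (2 * (‖c‖ + 1) * 2 ^ ‖l‖)) (by positivity)
  obtain ⟨M, hM0, hM⟩ := exists_norm_mul_cpow_lt_one hm r
  set R := max R₁ R₂
  have hR : 0 < R := hR₁.trans_le (le_max_left _ _)
  set s := ‖r‖ * R ^ (-m.re) with hs
  have hs0 : 0 ≤ s := by positivity
  have hs2 : s ≤ 1 / 2 := by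
    calc s ≤ ‖r‖ * (1 / (2 * (‖r‖ + 1))) := by
          rw [hs]; gcongr; exact hR₁' R (le_max_left _ _)
      _ ≤ 1 / 2 := by
          rw [mul_one_div, div_le_div_iff₀ (by positivity) (by norm_num)]; linarith
  set p := ‖c‖ * R ^ (-n.re) * 2 ^ ‖l‖ with hp
  have hp0 : 0 ≤ p := by positivity
  have hp2 : p ≤ 1 / 2 := by
    calc p ≤ ‖c‖ * (1 / (2 * (‖c‖ + 1) * 2 ^ ‖l‖)) * 2 ^ ‖l‖ := by
          rw [hp]; gcongr; exact hR₂' R (le_max_right _ _)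
      _ = ‖c‖ / (2 * (‖c‖ + 1)) := by field_simp
      _ ≤ 1 / 2 := by
          rw [div_le_div_iff₀ (by positivity) (by norm_num)]; linarith
  set K := |m.im| / m.re + |n.im| / n.re + |b.im| / b.re with hK
  have hA : Admissible (fun i : ℕ × ℕ => m * i.2 + (n * i.1 + b))
      (fun i => c ^ i.1 * (pc (l * i.1 + e) i.2 * r ^ i.2)) K R := by
    refine ⟨fun i => ?_, fun i => ?_, hR, ?_⟩
    · simp only [Complex.add_re, Complex.mul_re, Complex.natCast_re, Complex.natCast_im, mul_zero,
        sub_zero]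
      positivity
    · simp only [Complex.add_re, Complex.mul_re, Complex.natCast_re, Complex.natCast_im, mul_zero,
        sub_zero, Complex.add_im, Complex.mul_im, zero_add]
      have k1 : |m.im| ≤ K * m.re := by
        refine (abs_im_le_ratio_mul hm).trans (mul_le_mul_of_nonneg_right ?_ hm.le)
        have : 0 ≤ |n.im| / n.re + |b.im| / b.re := by positivity
        linarith
      have k2 : |n.im| ≤ K * n.re := by
        refine (abs_im_le_ratio_mul hn).trans (mul_le_mul_of_nonneg_right ?_ hn.le)
        have : 0 ≤ |m.im| / m.re + |b.im| / b.re := by positivity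
        linarith
      have k3 : |b.im| ≤ K * b.re := by
        refine (abs_im_le_ratio_mul hb).trans (mul_le_mul_of_nonneg_right ?_ hb.le)
        have : 0 ≤ |m.im| / m.re + |n.im| / n.re := by positivity
        linarith
      calc |m.im * i.2 + (n.im * i.1 + b.im)| ≤ |m.im| * i.2 + (|n.im| * i.1 + |b.im|) := by
            refine (abs_add_le _ _).trans (add_le_add ?_ ((abs_add_le _ _).trans ?_))
            · rw [abs_mul, Nat.abs_cast]
            · rw [abs_mul, Nat.abs_cast]
        _ ≤ K * m.re * i.2 + (K * n.re * i.1 + K * b.re) := by gcongr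
        _ = _ := by ring
    · have hmaj : Summable fun i : ℕ × ℕ => (‖c‖ * R ^ (-n.re)) ^ i.1 *
          (rpc (‖l‖ * i.1 + ‖e‖) i.2 * s ^ i.2) * R ^ (-b.re) := by
        refine Summable.mul_right _ ?_
        have hnn : ∀ i : ℕ × ℕ, 0 ≤ rpc (‖l‖ * i.1 + ‖e‖) i.2 :=
          fun i => rpc_nonneg (by positivity) _
        have hin : ∀ j : ℕ, HasSum (fun u => (‖c‖ * R ^ (-n.re)) ^ j *
            (rpc (‖l‖ * j + ‖e‖) u * s ^ u))
            ((‖c‖ * R ^ (-n.re)) ^ j * (1 - s) ^ (-(‖l‖ * j + ‖e‖))) :=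
          fun j => (hasSum_rpc _ hs0 (by linarith)).mul_left _
        refine (summable_prod_of_nonneg fun i => mul_nonneg (by positivity)
          (mul_nonneg (hnn i) (by positivity))).2 ⟨fun j => (hin j).summable, ?_⟩
        have hgeo : Summable fun j : ℕ => p ^ j * 2 ^ ‖e‖ :=
          (summable_geometric_of_lt_one hp0 (by linarith)).mul_right _
        refine Summable.of_nonneg_of_le (fun j => ?_) (fun j => ?_) hgeo
        · exact tsum_nonneg fun u => mul_nonneg (by positivity)
            (mul_nonneg (hnn (j, u)) (by positivity))
        · rw [(hin j).tsum_eq]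
          have h1 : (1 - s) ^ (-(‖l‖ * j + ‖e‖)) ≤ (2 ^ ‖l‖) ^ j * 2 ^ ‖e‖ := by
            calc (1 - s) ^ (-(‖l‖ * j + ‖e‖)) ≤ (1 / 2 : ℝ) ^ (-(‖l‖ * j + ‖e‖)) :=
                  Real.rpow_le_rpow_of_nonpos (by norm_num) (by linarith)
                    (by have : 0 ≤ ‖l‖ * j + ‖e‖ := by positivity
                        linarith)
              _ = _ := by
                  rw [one_div, Real.inv_rpow (by norm_num), ← Real.rpow_neg (by norm_num), neg_neg,
                    Real.rpow_add (by norm_num), Real.rpow_mul (by norm_num), Real.rpow_natCast]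
          calc _ ≤ (‖c‖ * R ^ (-n.re)) ^ j * ((2 ^ ‖l‖) ^ j * 2 ^ ‖e‖) := by gcongr
            _ = p ^ j * 2 ^ ‖e‖ := by rw [hp, mul_pow (‖c‖ * R ^ (-n.re))]; ring
      refine Summable.of_nonneg_of_le (fun _ => by positivity) (fun i => ?_) hmaj
      have hpc : ‖pc (l * i.1 + e) i.2‖ ≤ rpc (‖l‖ * i.1 + ‖e‖) i.2 := by
        refine norm_pc_le ((norm_add_le _ _).trans ?_) _
        rw [norm_mul, Complex.norm_natCast]
      simp only [Complex.add_re, Complex.mul_re, Complex.natCast_re, Complex.natCast_im, mul_zero,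
        sub_zero, norm_mul, norm_pow]
      rw [neg_add, neg_add, Real.rpow_add hR, Real.rpow_add hR, ← neg_mul, ← neg_mul,
        Real.rpow_mul hR.le, Real.rpow_mul hR.le, Real.rpow_natCast, Real.rpow_natCast]
      calc _ = (‖c‖ * R ^ (-n.re)) ^ i.1 * (‖pc (l * i.1 + e) i.2‖ * s ^ i.2) * R ^ (-b.re) := by
            rw [hs, mul_pow, mul_pow]; ring
        _ ≤ _ := by gcongr
  have key : ∀ z : ℂ, max M (absc K R) < z.re →
      1 - c * (z ^ (-n) * (1 - r * z ^ (-m)) ^ (-l)) ≠ 0 ∧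
      lap (gammaSeries (fun i : ℕ × ℕ => m * i.2 + (n * i.1 + b))
        (fun i => c ^ i.1 * (pc (l * i.1 + e) i.2 * r ^ i.2))) z =
      z ^ (-b) * (1 - r * z ^ (-m)) ^ (-e) /
        (1 - c * (z ^ (-n) * (1 - r * z ^ (-m)) ^ (-l))) := by
    intro z hz
    have hzM := (le_max_left _ _).trans hz.le
    have hz0 : z ≠ 0 := fun h => by rw [h] at hzM; simp at hzM; linarith
    have h1 := hA.hasSum_lap ((le_max_right _ _).trans hz.le)
    set w := r * z ^ (-m) with hw
    have hw1 : ‖w‖ < 1 := hM z hzM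
    have hw0 : 1 - w ≠ 0 := fun h => by
      rw [← sub_eq_zero.1 h] at hw1; simp at hw1
    set X := c * (z ^ (-n) * (1 - w) ^ (-l)) with hX
    have hinner : ∀ j : ℕ, HasSum (fun u : ℕ => c ^ j * (pc (l * j + e) u * r ^ u) *
        z ^ (-(m * u + (n * j + b)))) (z ^ (-b) * (1 - w) ^ (-e) * X ^ j) := by
      intro j
      have h2 := (hasSum_pc (l * j + e) hw1).mul_left (c ^ j * ((z ^ (-n)) ^ j * z ^ (-b)))
      have h3 : c ^ j * ((z ^ (-n)) ^ j * z ^ (-b)) * (1 - w) ^ (-(l * j + e)) =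
          z ^ (-b) * (1 - w) ^ (-e) * X ^ j := by
        rw [cpow_neg_mul_nat_add hw0, hX, mul_pow, mul_pow]; ring
      rw [h3] at h2
      refine h2.congr_fun fun u => ?_
      rw [cpow_neg_mul_nat_add hz0 m, cpow_neg_mul_nat_add hz0, hw, mul_pow]
      ring
    have h4 := h1.prod_fiberwise hinner
    have hne : z ^ (-b) * (1 - w) ^ (-e) ≠ 0 := by
      simp [Complex.cpow_eq_zero_iff, hz0, hw0]
    -- the geometric series converges because the double series does
    have hX1 : ‖X‖ < 1 := by
      have := h4.summable
      rw [summable_mul_left_iff hne] at this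
      exact summable_geometric_iff_norm_lt_one.1 this
    refine ⟨fun h => ?_, ?_⟩
    · rw [← sub_eq_zero.1 h] at hX1; simp at hX1
    · rw [h4.unique ((hasSum_geometric_of_norm_lt_one hX1).mul_left _), ← div_eq_mul_inv]
  exact ⟨_, ⟨hA.expClassC, _, fun z hz => (key z hz).2⟩, _, fun z hz => (key z hz).1⟩

end LaplaceC

/-! ### Repeated integration of the highest derivative -/

namespace LaplaceC

theorem _root_.AbsolutelyContinuousOnInterval.lipschitz_comp {X Y : Type*} [PseudoMetricSpace X]
    [PseudoMetricSpace Y] {F : ℝ → X} {a b : ℝ} (hF : AbsolutelyContinuousOnInterval F a b)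
    {G : X → Y} (hG : LipschitzWith 1 G) : AbsolutelyContinuousOnInterval (fun t => G (F t)) a b :=
  squeeze_zero (fun _ => Finset.sum_nonneg fun _ _ => dist_nonneg)
    (fun _ => Finset.sum_le_sum fun _ _ => by simpa using hG.dist_le_mul _ _) hF

/-- The fundamental theorem of calculus for complex-valued absolutely continuous functions. -/
theorem integral_deriv_of_absolutelyContinuous {F : ℝ → ℂ} {b : ℝ} (hb : 0 < b)
    (hF : AbsolutelyContinuousOnInterval F 0 b) :
    IntegrableOn (deriv F) (Ioo 0 b) ∧
      ∀ t ∈ Ioo 0 b, ∫ s in Ioo 0 t, deriv F s = F t - F 0 := by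
  have hre := hF.lipschitz_comp (G := Complex.re)
    (LipschitzWith.of_dist_le_mul fun x y => by
      simpa [Complex.dist_eq, Real.dist_eq] using Complex.abs_re_le_norm (x - y))
  have him := hF.lipschitz_comp (G := Complex.im)
    (LipschitzWith.of_dist_le_mul fun x y => by
      simpa [Complex.dist_eq, Real.dist_eq] using Complex.abs_im_le_norm (x - y))
  have hd : ∀ᵐ t, t ∈ uIcc 0 b → deriv F t =
      ((deriv (fun t => (F t).re) t : ℝ) : ℂ) + (deriv (fun t => (F t).im) t : ℝ) * Complex.I := by
    filter_upwards [hre.ae_differentiableAt, him.ae_differentiableAt] with t h1 h2 ht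
    have h3 := ((h1 ht).hasDerivAt.ofReal_comp).add
      (((h2 ht).hasDerivAt.ofReal_comp).mul_const Complex.I)
    have h4 : (fun t => (((F t).re : ℝ) : ℂ)) + (fun t => (((F t).im : ℝ) : ℂ) * Complex.I)
        = F := by
      funext t; simp
    rw [h4] at h3
    exact h3.deriv
  have hsub : ∀ t ∈ Icc 0 b, Ioo 0 t ⊆ uIcc 0 b := fun t ht s hs => by
    rw [uIcc_of_le hb.le]; exact ⟨hs.1.le, hs.2.le.trans ht.2⟩
  have hae : ∀ t ∈ Icc 0 b, deriv F =ᵐ[volume.restrict (Ioo 0 t)] fun t =>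
      ((deriv (fun t => (F t).re) t : ℝ) : ℂ) + (deriv (fun t => (F t).im) t : ℝ) * Complex.I := by
    intro t ht
    rw [EventuallyEq, ae_restrict_iff' measurableSet_Ioo]
    filter_upwards [hd] with s hs hs'
    exact hs (hsub t ht hs')
  have hire := (intervalIntegrable_iff_integrableOn_Ioo_of_le hb.le).1 hre.intervalIntegrable_deriv
  have hiim := (intervalIntegrable_iff_integrableOn_Ioo_of_le hb.le).1 him.intervalIntegrable_deriv
  refine ⟨?_, fun t ht => ?_⟩
  · refine Integrable.congr ?_ (hae b ⟨hb.le, le_rfl⟩).symm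
    exact hire.ofReal.add (hiim.ofReal.mul_const _)
  · have hmono : uIcc 0 t ⊆ uIcc 0 b := by
      rw [uIcc_of_le hb.le, uIcc_of_le ht.1.le]; exact Icc_subset_Icc_right ht.2.le
    have hs : Ioo 0 t ⊆ Ioo 0 b := Ioo_subset_Ioo_right ht.2.le
    have e1 := (hre.mono hmono).integral_deriv_eq_sub
    have e2 := (him.mono hmono).integral_deriv_eq_sub
    rw [intervalIntegral.integral_of_le ht.1.le, integral_Ioc_eq_integral_Ioo] at e1 e2
    rw [integral_congr_ae (hae t ⟨ht.1.le, ht.2.le⟩), integral_add (hire.mono_set hs).ofReal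
      ((hiim.mono_set hs).ofReal.mul_const _), integral_mul_const, integral_complex_ofReal,
      integral_complex_ofReal, e1, e2]
    apply Complex.ext <;> simp

theorem lapInt_one {c : ℝ} (hc : 0 < c) : LapInt (fun _ => 1) c := by
  simpa using lapInt_cpow (a := 1) (by simp) hc

theorem lap_one {z : ℂ} (hz : 0 < z.re) : lap (fun _ => 1) z = z⁻¹ := by
  simpa [Complex.cpow_neg_one] using lap_cpow (a := 1) (by simp) hz

theorem lapInt_indicator_Ioo {φ : ℝ → ℂ} {b : ℝ} (h : IntegrableOn φ (Ioo 0 b)) {c : ℝ}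
    (hc : 0 ≤ c) : LapInt ((Ioo 0 b).indicator φ) c := by
  have h1 : IntegrableOn ((Ioo 0 b).indicator φ) (Ioi 0) :=
    ((integrable_indicator_iff measurableSet_Ioo).2 h).integrableOn
  have h2 : LapInt ((Ioo 0 b).indicator φ) 0 := by simpa [LapInt] using h1
  exact h2.mono hc

theorem hasDerivAt_iteratedDeriv {f : ℝ → ℂ} {k p : ℕ} (h : ContDiffOn ℝ (k : ℕ∞) f (Ioi 0))
    (hp : p < k) {t : ℝ} (ht : 0 < t) :
    HasDerivAt (iteratedDeriv p f) (iteratedDeriv (p + 1) f t) t := by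
  have h1 := h.differentiableOn_iteratedDerivWithin (m := p) (by exact_mod_cast hp)
    isOpen_Ioi.uniqueDiffOn
  have h2 : DifferentiableOn ℝ (iteratedDeriv p f) (Ioi 0) :=
    h1.congr fun s hs => (iteratedDerivWithin_of_isOpen isOpen_Ioi hs).symm
  rw [iteratedDeriv_succ]
  exact (h2.differentiableAt (isOpen_Ioi.mem_nhds ht)).hasDerivAt

theorem integrableOn_iteratedDeriv_of_acLoc {f : ℝ → ℂ} {k : ℕ} (hk : 1 ≤ k) (hf : ACLoc k f)
    {τ : ℂ} (h0 : Tendsto (iteratedDeriv (k - 1) f) (𝓝[>] 0) (𝓝 τ)) {b : ℝ} (hb : 0 < b) :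
    IntegrableOn (iteratedDeriv k f) (Ioo 0 b) ∧
      ∀ t ∈ Ioo 0 b, ∫ s in Ioo 0 t, iteratedDeriv k f s = iteratedDeriv (k - 1) f t - τ := by
  obtain ⟨F, hF, hFe⟩ := hf.2 b hb
  have hk1 : k - 1 + 1 = k := by omega
  have hde : EqOn (deriv F) (iteratedDeriv k f) (Ioo 0 b) := by
    intro t ht
    rw [← hk1, iteratedDeriv_succ]
    exact (hFe.eventuallyEq_of_mem (isOpen_Ioo.mem_nhds ht)).deriv_eq
  have hF0 : F 0 = τ := by
    have h1 : Tendsto F (𝓝[>] 0) (𝓝 (F 0)) := by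
      have := hF.continuousOn 0 left_mem_uIcc
      rw [uIcc_of_le hb.le] at this
      exact (this.mono Ioo_subset_Icc_self).tendsto.mono_left
        (by rw [nhdsWithin_Ioo_eq_nhdsGT hb])
    refine tendsto_nhds_unique h1 (h0.congr' ?_)
    filter_upwards [Ioo_mem_nhdsGT hb] with t ht
    exact (hFe ht).symm
  obtain ⟨h1, h2⟩ := integral_deriv_of_absolutelyContinuous hb hF
  refine ⟨h1.congr_fun hde measurableSet_Ioo, fun t ht => ?_⟩
  rw [← hFe ht, ← hF0, ← h2 t ht]
  exact setIntegral_congr_fun measurableSet_Ioo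
    (hde.mono (Ioo_subset_Ioo_right ht.2.le)).symm

/-- The `k`-fold integral of the truncation to `(0, b)` of the derivative of order `k` has Laplace
transform `z ^ (-k)` times that of the truncation, and equals `f - f(0+)` on `(0, b)`. The
truncation is needed because the derivative itself need not be of exponential order. -/
theorem exists_iterated_integral {f : ℝ → ℂ} {k : ℕ} (hk : 1 ≤ k) (hf : ACLoc k f) {τ : ℂ}
    (h0 : Tendsto f (𝓝[>] 0) (𝓝 τ))
    (hp : ∀ p : ℕ, 1 ≤ p → p < k → Tendsto (iteratedDeriv p f) (𝓝[>] 0) (𝓝 0))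
    {b : ℝ} (hb : 0 < b) :
    IntegrableOn (iteratedDeriv k f) (Ioo 0 b) ∧
    ∃ u : ℝ → ℂ, (∀ c : ℝ, 0 < c → LapInt u c) ∧
      (∀ z : ℂ, 0 < z.re →
        lap u z = (z⁻¹) ^ k * lap ((Ioo 0 b).indicator (iteratedDeriv k f)) z) ∧
      ∀ t ∈ Ioo 0 b, u t = f t - τ := by
  have hlim : ∀ p < k, Tendsto (iteratedDeriv p f) (𝓝[>] 0) (𝓝 (if p = 0 then τ else 0)) := by
    intro p hpk
    rcases p with _ | p
    · simpa using h0
    · simpa using hp (p + 1) (by omega) hpk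
  have hint := (integrableOn_iteratedDeriv_of_acLoc hk hf (hlim (k - 1) (by omega)) hb)
  refine ⟨hint.1, ?_⟩
  set Φ := (Ioo 0 b).indicator (iteratedDeriv k f) with hΦ
  have hΦL : ∀ c : ℝ, 0 < c → LapInt Φ c := fun c hc => lapInt_indicator_Ioo hint.1 hc.le
  have main : ∀ j < k, ∃ u : ℝ → ℂ, (∀ c : ℝ, 0 < c → LapInt u c) ∧
      (∀ z : ℂ, 0 < z.re → lap u z = (z⁻¹) ^ (j + 1) * lap Φ z) ∧
      ∀ t ∈ Ioo 0 b, u t =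
        iteratedDeriv (k - 1 - j) f t - (if k - 1 - j = 0 then τ else 0) := by
    intro j
    induction j with
    | zero =>
      intro _
      refine ⟨cconv (fun _ => 1) Φ, fun c hc => (lapInt_one hc).cconv (hΦL c hc), fun z hz => ?_,
        fun t ht => ?_⟩
      · rw [lap_cconv (lapInt_one hz) (hΦL _ hz) le_rfl, lap_one hz]; simp
      · simp only [cconv, one_mul, Nat.sub_zero]
        rw [← hint.2 t ht]
        refine setIntegral_congr_fun measurableSet_Ioo fun s hs => ?_
        simp [hΦ, hs.1, hs.2.trans ht.2]
    | succ j ih =>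
      intro hj
      obtain ⟨u, hu, hul, hut⟩ := ih (by omega)
      refine ⟨cconv (fun _ => 1) u, fun c hc => (lapInt_one hc).cconv (hu c hc), fun z hz => ?_,
        fun t ht => ?_⟩
      · rw [lap_cconv (lapInt_one hz) (hu _ hz) le_rfl, lap_one hz, hul z hz, pow_succ' _ (j + 1)]
        ring
      · have hidx : k - 1 - j = (k - 1 - (j + 1)) + 1 := by omega
        rw [hidx] at hut
        simp only [cconv, one_mul]
        set p := k - 1 - (j + 1) with hpdef
        have hpk : p < k - 1 := by omega
        have e : ∀ s ∈ Ioo 0 t, u s = iteratedDeriv (p + 1) f s := fun s hs => by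
          have := hut s ⟨hs.1, hs.2.trans ht.2⟩
          simpa using this
        rw [setIntegral_congr_fun measurableSet_Ioo e, ← integral_Ioc_eq_integral_Ioo,
          ← intervalIntegral.integral_of_le ht.1.le]
        refine intervalIntegral.integral_eq_sub_of_hasDerivAt_of_tendsto ht.1
          (fun s hs => hasDerivAt_iteratedDeriv hf.1 hpk hs.1) ?_ (hlim p (by omega)) ?_
        · rw [intervalIntegrable_iff_integrableOn_Ioo_of_le ht.1.le]
          exact ((hu 1 one_pos).integrableOn_Ioo t).congr_fun e measurableSet_Ioo
        · exact (hasDerivAt_iteratedDeriv hf.1 hpk ht.1).continuousAt.tendsto.mono_left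
            nhdsWithin_le_nhds
  obtain ⟨u, hu, hul, hut⟩ := main (k - 1) (by omega)
  refine ⟨u, hu, fun z hz => ?_, fun t ht => ?_⟩
  · rw [hul z hz, Nat.sub_add_cancel hk]
  · simpa using hut t ht

end LaplaceC

/-! ### The scalar equation -/

namespace LaplaceC

theorem InvLap.exists_lapInt {φ : ℝ → ℂ} {F : ℂ → ℂ} (h : InvLap F φ) :
    ∃ c : ℝ, ∀ c' : ℝ, c ≤ c' → LapInt φ c' ∧ ∀ z : ℂ, c' ≤ z.re → lap φ z = F z := by
  obtain ⟨c, hc⟩ := LaplaceC.exists_lapInt h.1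
  obtain ⟨M, hM⟩ := h.2
  exact ⟨max c (M + 1), fun c' hc' => ⟨hc.mono ((le_max_left _ _).trans hc'), fun z hz =>
    hM z (by linarith [(le_max_right c (M + 1)).trans (hc'.trans hz)])⟩⟩

theorem cpow_ne_zero {z : ℂ} (hz : z ≠ 0) (a : ℂ) : z ^ a ≠ 0 := by
  simp [Complex.cpow_eq_zero_iff, hz]

/-- The transform of the Prabhakar operator of order `a`, identity part included when `a = 0`,
is multiplication by `z ^ (-a) (1 - r z ^ (-m)) ^ (-l)`. -/
theorem exists_lap_prabhakar {m a : ℂ} (hm : 0 < m.re) (ha : a = 0 ∨ 0 < a.re) (r l : ℂ) :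
    ∃ c : ℝ, ∀ c' : ℝ, c ≤ c' → LapInt (ker m a r l) c' ∧ ∀ z : ℂ, c' ≤ z.re →
      (if a = 0 then 1 else 0) + lap (ker m a r l) z =
        z ^ (-a) * (1 - r * z ^ (-m)) ^ (-l) := by
  by_cases h0 : a = 0
  · subst h0
    obtain ⟨c, hc⟩ := (invLap_ker_zero hm r l).exists_lapInt
    refine ⟨c, fun c' hc' => ⟨(hc c' hc').1, fun z hz => ?_⟩⟩
    rw [(hc c' hc').2 z hz]
    simp
  · obtain ⟨c, hc⟩ := (invLap_ker hm (ha.resolve_left h0) r l).exists_lapInt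
    refine ⟨c, fun c' hc' => ⟨(hc c' hc').1, fun z hz => ?_⟩⟩
    rw [(hc c' hc').2 z hz]
    simp [h0]

/-- Convolving the equation with the Prabhakar kernel of order `n` turns it into a Volterra
equation, since the composed kernels have transform `z ^ (-k)`, that of `k`-fold integration. On
`(0, b)` only the truncation of `f ^ (k)` to `(0, b)` enters, to which the Laplace transform
applies. -/
theorem volterra_of_regPrabhakar {m n r l κ τ : ℂ} {k : ℕ} (hm : 0 < m.re) (hn : 0 < n.re)
    (hk : 1 ≤ k) (hnk : n = k ∨ n.re < k) {f g : ℝ → ℂ} (hf : ACLoc k f)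
    (heq : ∀ᵐ t ∂(volume.restrict (Ioi (0 : ℝ))),
      (if (k : ℂ) - n = 0 then 1 else 0) * iteratedDeriv k f t +
        cconv (ker m (k - n) r (-l)) (iteratedDeriv k f) t + κ * f t = g t)
    (h0 : Tendsto f (𝓝[>] 0) (𝓝 τ))
    (hp : ∀ p : ℕ, 1 ≤ p → p < k → Tendsto (iteratedDeriv p f) (𝓝[>] 0) (𝓝 0)) :
    ∀ᵐ t ∂(volume.restrict (Ioi (0 : ℝ))),
      f t - τ = cconv (ker m n r l) (fun s => g s - κ * f s) t := by
  have ha : (k : ℂ) - n = 0 ∨ 0 < ((k : ℂ) - n).re := by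
    rcases hnk with h | h
    · left; rw [h, sub_self]
    · right; simpa using h
  obtain ⟨c₁, hc₁⟩ := (invLap_ker hm hn r l).exists_lapInt
  obtain ⟨c₂, hc₂⟩ := exists_lap_prabhakar hm ha r (-l)
  obtain ⟨c₃, hc₃, hw⟩ := exists_norm_mul_cpow_lt_one hm r
  set c := max c₃ (max c₁ c₂)
  obtain ⟨hE, hEl⟩ := hc₁ c ((le_max_left _ _).trans (le_max_right _ _))
  obtain ⟨hD, hDl⟩ := hc₂ c ((le_max_right _ _).trans (le_max_right _ _))
  have hc3 : c₃ ≤ c := le_max_left _ _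
  have hcpos : 0 < c := hc₃.trans_le hc3
  have hb : ∀ N : ℕ, ∀ᵐ t ∂(volume.restrict (Ioi (0 : ℝ))), t < (N : ℝ) + 1 →
      f t - τ = cconv (ker m n r l) (fun s => g s - κ * f s) t := by
    intro N
    have hb0 : (0 : ℝ) < (N : ℝ) + 1 := by positivity
    set b := (N : ℝ) + 1
    obtain ⟨hint, u, hu, hul, hut⟩ := exists_iterated_integral hk hf h0 hp hb0
    set Φ := (Ioo 0 b).indicator (iteratedDeriv k f) with hΦ
    have hΦL : LapInt Φ c := lapInt_indicator_Ioo hint hcpos.le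
    set δ : ℂ := if (k : ℂ) - n = 0 then 1 else 0
    set G : ℝ → ℂ := fun t => δ * Φ t + cconv (ker m (k - n) r (-l)) Φ t with hG
    have hGL : LapInt G c := (hΦL.const_mul δ).add (hD.cconv hΦL)
    have hGl : ∀ z : ℂ, c ≤ z.re →
        lap G z = z ^ (-((k : ℂ) - n)) * (1 - r * z ^ (-m)) ^ (-(-l)) * lap Φ z := by
      intro z hz
      rw [← hDl z hz, hG, lap_add (hΦL.const_mul δ) (hD.cconv hΦL) hz, lap_const_mul,
        lap_cconv hD hΦL hz, add_mul]
    -- both sides have transform `z ^ (-k)` times that of `Φ`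
    have hue : cconv (ker m n r l) G =ᵐ[volume.restrict (Ioi 0)] u := by
      refine ae_eq_of_lap_eq (hE.cconv hGL) (hu c hcpos) fun z hz => ?_
      have hz0 : 0 < z.re := hcpos.trans_le hz
      have hne : z ≠ 0 := fun h => by simp [h] at hz0
      have hw1 : 1 - r * z ^ (-m) ≠ 0 := fun h => by
        have := hw z (hc3.trans hz)
        rw [← sub_eq_zero.1 h] at this; simp at this
      rw [lap_cconv hE hGL hz, hEl z hz, hGl z hz, hul z hz0]
      have e1 : z ^ (-((k : ℂ) - n)) = (z⁻¹) ^ k * z ^ n := by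
        rw [neg_sub, sub_eq_add_neg, Complex.cpow_add _ _ hne, Complex.cpow_neg,
          Complex.cpow_natCast, inv_pow, mul_comm]
      rw [e1, neg_neg, Complex.cpow_neg, Complex.cpow_neg _ l]
      have h1 := cpow_ne_zero hne n
      have h2 := cpow_ne_zero hw1 l
      field_simp
    -- the truncation is not seen before `b`, as convolution at `s` only uses values on `(0, s)`
    have hGg : ∀ᵐ s ∂volume, s ∈ Ioo 0 b → G s = g s - κ * f s := by
      filter_upwards [(ae_restrict_iff' measurableSet_Ioi).1 heq] with s hs hsb
      rw [← hs hsb.1, add_sub_cancel_right, hG]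
      have e1 : Φ s = iteratedDeriv k f s := by simp [hΦ, hsb.1, hsb.2]
      have e2 : cconv (ker m (k - n) r (-l)) Φ s =
          cconv (ker m (k - n) r (-l)) (iteratedDeriv k f) s := by
        refine setIntegral_congr_fun measurableSet_Ioo fun x hx => ?_
        simp [hΦ, hx.1, hx.2.trans hsb.2]
      simp only [e1, e2]
    filter_upwards [hue, ae_restrict_mem measurableSet_Ioi] with t ht ht0 htb
    rw [← hut t ⟨ht0, htb⟩, ← ht]
    refine setIntegral_congr_ae measurableSet_Ioo ?_
    filter_upwards [hGg] with s hs hst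
    rw [hs ⟨hst.1, hst.2.trans htb⟩]
  filter_upwards [ae_all_iff.2 hb] with t ht
  obtain ⟨N, hN⟩ := exists_nat_gt t
  exact ht N (by linarith)

/-- The scalar symbol `z ^ n (1 - r z ^ (-m)) ^ l`. -/
def csymb (m n r l z : ℂ) : ℂ := z ^ n * (1 - r * z ^ (-m)) ^ l

/-- Far to the right, the algebra relating the symbol, its inverse and the two transforms. -/
theorem exists_csymb_ne_zero {m n : ℂ} (hm : 0 < m.re) (hn : 0 < n.re) (r l κ : ℂ) :
    ∃ M : ℝ, 0 < M ∧ ∀ z : ℂ, M < z.re → z ≠ 0 ∧ csymb m n r l z ≠ 0 ∧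
      csymb m n r l z + κ ≠ 0 ∧
      z ^ (-n) * (1 - r * z ^ (-m)) ^ (-l) = (csymb m n r l z)⁻¹ ∧
      z ^ (n - 1) * (1 - r * z ^ (-m)) ^ l = csymb m n r l z / z := by
  obtain ⟨M₁, hM₁, hw⟩ := exists_norm_mul_cpow_lt_one hm r
  obtain ⟨-, -, M₂, h2⟩ := exists_invLap_resolvent hm hn hn r l l (-κ)
  refine ⟨max M₁ M₂, hM₁.trans_le (le_max_left _ _), fun z hz => ?_⟩
  have hz1 := (le_max_left _ _).trans_lt hz
  have hz0 : 0 < z.re := hM₁.trans hz1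
  have hne : z ≠ 0 := fun h => by simp [h] at hz0
  have hw1 : 1 - r * z ^ (-m) ≠ 0 := fun h => by
    have := hw z hz1.le
    rw [← sub_eq_zero.1 h] at this; simp at this
  have hS : csymb m n r l z ≠ 0 := mul_ne_zero (cpow_ne_zero hne n) (cpow_ne_zero hw1 l)
  have hinv : z ^ (-n) * (1 - r * z ^ (-m)) ^ (-l) = (csymb m n r l z)⁻¹ := by
    rw [csymb, Complex.cpow_neg, Complex.cpow_neg, mul_inv]
  refine ⟨hne, hS, fun h => ?_, hinv, ?_⟩
  · have h3 := h2 z ((le_max_right _ _).trans_lt hz)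
    rw [hinv, eq_neg_of_add_eq_zero_right h] at h3
    simp [hS] at h3
  · rw [Complex.cpow_sub _ _ hne, Complex.cpow_one, csymb]; ring

theorem exists_invLap_one_div_csymb_add {m n : ℂ} (hm : 0 < m.re) (hn : 0 < n.re) (r l κ : ℂ) :
    ∃ h, InvLap (fun z => 1 / (csymb m n r l z + κ)) h := by
  obtain ⟨h, hh, -⟩ := exists_invLap_resolvent hm hn hn r l l (-κ)
  obtain ⟨M, hM0, hM⟩ := exists_csymb_ne_zero hm hn r l κ
  refine ⟨h, hh.congr_transform M fun z hz => ?_⟩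
  obtain ⟨h1, h2, h3, h4, h5⟩ := hM z hz
  rw [h4]
  have : 1 - -κ * (csymb m n r l z)⁻¹ = (csymb m n r l z + κ) / csymb m n r l z := by
    field_simp; ring
  rw [this]
  field_simp

theorem exists_invLap_csymb_div_div {m n : ℂ} (hm : 0 < m.re) (hn : 0 < n.re) (r l κ : ℂ) :
    ∃ q, InvLap (fun z => z ^ (n - 1) * (1 - r * z ^ (-m)) ^ l / (csymb m n r l z + κ)) q := by
  obtain ⟨q, hq, -⟩ := exists_invLap_resolvent hm hn (b := 1) (by simp) r l 0 (-κ)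
  obtain ⟨M, hM0, hM⟩ := exists_csymb_ne_zero hm hn r l κ
  refine ⟨q, hq.congr_transform M fun z hz => ?_⟩
  obtain ⟨h1, h2, h3, h4, h5⟩ := hM z hz
  rw [h4, h5]
  have : 1 - -κ * (csymb m n r l z)⁻¹ = (csymb m n r l z + κ) / csymb m n r l z := by
    field_simp; ring
  rw [this, neg_zero, Complex.cpow_zero, Complex.cpow_neg_one]
  field_simp

theorem invLap_ker_csymb {m n : ℂ} (hm : 0 < m.re) (hn : 0 < n.re) (r l : ℂ) :
    InvLap (fun z => 1 / csymb m n r l z) (ker m n r l) := by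
  obtain ⟨M, hM0, hM⟩ := exists_csymb_ne_zero hm hn r l 0
  refine (invLap_ker hm hn r l).congr_transform M fun z hz => ?_
  rw [(hM z hz).2.2.2.1, one_div]

/-- Solving the transformed Volterra equation `F - τ / z = (G - κ F) / S` for `F`. -/
theorem solution_formula {m n r l κ τ : ℂ} (hm : 0 < m.re) (hn : 0 < n.re) {f g h q : ℝ → ℂ}
    (hf : ExpClassC f) (hg : ExpClassC g)
    (hV : ∀ᵐ t ∂(volume.restrict (Ioi (0 : ℝ))),
      f t - τ = cconv (ker m n r l) (fun s => g s - κ * f s) t)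
    (hh : InvLap (fun z => 1 / (csymb m n r l z + κ)) h)
    (hq : InvLap (fun z => z ^ (n - 1) * (1 - r * z ^ (-m)) ^ l / (csymb m n r l z + κ)) q) :
    ∀ᵐ t ∂(volume.restrict (Ioi (0 : ℝ))), f t = cconv h g t + τ * q t := by
  obtain ⟨M, hM0, hM⟩ := exists_csymb_ne_zero hm hn r l κ
  obtain ⟨c₁, h₁⟩ := LaplaceC.exists_lapInt hf
  obtain ⟨c₂, h₂⟩ := LaplaceC.exists_lapInt hg
  obtain ⟨c₃, h₃⟩ := hh.exists_lapInt
  obtain ⟨c₄, h₄⟩ := hq.exists_lapInt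
  obtain ⟨c₅, h₅⟩ := (invLap_ker_csymb hm hn r l).exists_lapInt
  obtain ⟨c, hc⟩ : ∃ c, M < c ∧ c₁ ≤ c ∧ c₂ ≤ c ∧ c₃ ≤ c ∧ c₄ ≤ c ∧ c₅ ≤ c :=
    ((eventually_gt_atTop M).and <| (eventually_ge_atTop c₁).and <| (eventually_ge_atTop c₂).and <|
      (eventually_ge_atTop c₃).and <| (eventually_ge_atTop c₄).and (eventually_ge_atTop c₅)).exists
  obtain ⟨hcM, hc1, hc2, hc3, hc4, hc5⟩ := hc
  have hF := h₁.mono hc1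
  have hG := h₂.mono hc2
  obtain ⟨hH, hHl⟩ := h₃ c hc3
  obtain ⟨hQ, hQl⟩ := h₄ c hc4
  obtain ⟨hE, hEl⟩ := h₅ c hc5
  refine ae_eq_of_lap_eq hF ((hH.cconv hG).add (hQ.const_mul τ)) fun z hz => ?_
  have hz0 : 0 < z.re := (hM0.trans hcM).trans_le hz
  obtain ⟨k1, k2, k3, k4, k5⟩ := hM z (hcM.trans_le hz)
  have h1 : LapInt (fun _ => (1 : ℂ)) c := lapInt_one (hM0.trans hcM)
  have hV' := lap_congr hV z
  have hone : (fun t => f t - τ) = fun t => f t - τ * 1 := by simp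
  rw [hone, lap_sub hF (h1.const_mul τ) hz, lap_const_mul, lap_one hz0,
    lap_cconv hE (hG.sub (hF.const_mul κ)) hz, lap_sub hG (hF.const_mul κ) hz, lap_const_mul,
    hEl z hz] at hV'
  rw [lap_add (hH.cconv hG) (hQ.const_mul τ) hz, lap_cconv hH hG hz, lap_const_mul, hHl z hz,
    hQl z hz, k5]
  set S := csymb m n r l z
  have hV2 : (S + κ) * lap f z = lap g z + τ * (S / z) := by
    have : S * (lap f z - τ * z⁻¹) = lap g z - κ * lap f z := by
      rw [hV']; field_simp
    linear_combination this
  have : lap f z = (lap g z + τ * (S / z)) / (S + κ) := by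
    rw [eq_div_iff k3, mul_comm, hV2]
  rw [this]
  ring

end LaplaceC

/-! ### Passage to idempotent components -/

namespace LaplaceC

theorem P₁_cpow (ξ η : Bicomplex) : P₁ (ξ ^ η) = P₁ ξ ^ P₁ η := P₁_ofIdem _ _

theorem P₂_cpow (ξ η : Bicomplex) : P₂ (ξ ^ η) = P₂ ξ ^ P₂ η := P₂_ofIdem _ _

theorem P₁_inv (ξ : Bicomplex) : P₁ ξ⁻¹ = (P₁ ξ)⁻¹ := P₁_ofIdem _ _

theorem P₂_inv (ξ : Bicomplex) : P₂ ξ⁻¹ = (P₂ ξ)⁻¹ := P₂_ofIdem _ _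

theorem P₁_div (ξ η : Bicomplex) : P₁ (ξ / η) = P₁ ξ / P₁ η := by
  rw [show ξ / η = ξ * η⁻¹ from rfl, map_mul, P₁_inv, div_eq_mul_inv]

theorem P₂_div (ξ η : Bicomplex) : P₂ (ξ / η) = P₂ ξ / P₂ η := by
  rw [show ξ / η = ξ * η⁻¹ from rfl, map_mul, P₂_inv, div_eq_mul_inv]

theorem P₁_ofReal (t : ℝ) : P₁ (ofReal t) = t := by simp [P₁, ofReal, ofComplex]

theorem P₂_ofReal (t : ℝ) : P₂ (ofReal t) = t := by simp [P₂, ofReal, ofComplex]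

theorem P₁_prabhakarKernel (m n r l : Bicomplex) (t : ℝ) :
    P₁ (prabhakarKernel m n r l t) = ker (P₁ m) (P₁ n) (P₁ r) (P₁ l) t := by
  rw [prabhakarKernel, map_mul, P₁_cpow, prabhakarE, bcTsum, P₁_ofIdem, ker]
  simp only [map_mul, P₁_div, P₁_cpow, map_sub, map_one, map_pow, map_natCast, P₁_ofReal, Gamma₂,
    P₁_ofIdem, map_add]
  simp only [← ascPochhammer_map P₁, Polynomial.eval_map_apply]

theorem P₂_prabhakarKernel (m n r l : Bicomplex) (t : ℝ) :
    P₂ (prabhakarKernel m n r l t) = ker (P₂ m) (P₂ n) (P₂ r) (P₂ l) t := by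
  rw [prabhakarKernel, map_mul, P₂_cpow, prabhakarE, bcTsum, P₂_ofIdem, ker]
  simp only [map_mul, P₂_div, P₂_cpow, map_sub, map_one, map_pow, map_natCast, P₂_ofReal, Gamma₂,
    P₂_ofIdem, map_add]
  simp only [← ascPochhammer_map P₂, Polynomial.eval_map_apply]

theorem P₁_conv (f g : ℝ → Bicomplex) (t : ℝ) :
    P₁ (conv f g t) = cconv (fun s => P₁ (f s)) (fun s => P₁ (g s)) t := by
  simp only [conv, bcIntegral, P₁_ofIdem, map_mul, cconv]

theorem P₂_conv (f g : ℝ → Bicomplex) (t : ℝ) :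
    P₂ (conv f g t) = cconv (fun s => P₂ (f s)) (fun s => P₂ (g s)) t := by
  simp only [conv, bcIntegral, P₂_ofIdem, map_mul, cconv]

theorem P₁_laplace (f : ℝ → Bicomplex) (ξ : Bicomplex) :
    P₁ (laplace f ξ) = lap (fun t => P₁ (f t)) (P₁ ξ) := by
  simp only [laplace, bcIntegral, P₁_ofIdem, map_mul, Bicomplex.exp, map_neg, P₁_ofReal, lap]

theorem P₂_laplace (f : ℝ → Bicomplex) (ξ : Bicomplex) :
    P₂ (laplace f ξ) = lap (fun t => P₂ (f t)) (P₂ ξ) := by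
  simp only [laplace, bcIntegral, P₂_ofIdem, map_mul, Bicomplex.exp, map_neg, P₂_ofReal, lap]

theorem P₁_re (ξ : Bicomplex) : (P₁ ξ).re = ξ.re + ξ.imJ := by
  simp [P₁, Bicomplex.re, imJ]

theorem P₂_re (ξ : Bicomplex) : (P₂ ξ).re = ξ.re - ξ.imJ := by
  simp [P₂, Bicomplex.re, imJ, sub_eq_add_neg]

/-- The domain `Re ξ > M + |Im_j ξ|` is a product of two right half-planes. -/
theorem add_abs_imJ_lt_re_iff (M : ℝ) (ξ : Bicomplex) :
    M + |ξ.imJ| < ξ.re ↔ M < (P₁ ξ).re ∧ M < (P₂ ξ).re := by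
  rw [P₁_re, P₂_re, ← lt_sub_iff_add_lt', abs_lt]
  constructor <;> rintro ⟨h1, h2⟩ <;> constructor <;> linarith

theorem re_pos_of_abs_imJ_lt {m : Bicomplex} (h : |m.imJ| < m.re) :
    0 < (P₁ m).re ∧ 0 < (P₂ m).re :=
  (add_abs_imJ_lt_re_iff 0 m).1 (by simpa using h)

theorem isInvLaplace_iff {F : Bicomplex → Bicomplex} {F₁ F₂ : ℂ → ℂ} {h : ℝ → Bicomplex}
    (h₁ : ∀ ξ, P₁ (F ξ) = F₁ (P₁ ξ)) (h₂ : ∀ ξ, P₂ (F ξ) = F₂ (P₂ ξ)) :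
    IsInvLaplace F h ↔ InvLap F₁ (fun t => P₁ (h t)) ∧ InvLap F₂ (fun t => P₂ (h t)) := by
  constructor
  · rintro ⟨⟨he1, he2⟩, M, hM⟩
    have hdiag : ∀ z : ℂ, M < z.re → laplace h (ofIdem z z) = F (ofIdem z z) := fun z hz =>
      hM _ ((add_abs_imJ_lt_re_iff _ _).2 (by simpa using hz))
    refine ⟨⟨he1, M, fun z hz => ?_⟩, ⟨he2, M, fun z hz => ?_⟩⟩
    · have := congrArg P₁ (hdiag z hz)
      rwa [P₁_laplace, h₁, P₁_ofIdem] at this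
    · have := congrArg P₂ (hdiag z hz)
      rwa [P₂_laplace, h₂, P₂_ofIdem] at this
  · rintro ⟨⟨he1, M₁, hM₁⟩, ⟨he2, M₂, hM₂⟩⟩
    refine ⟨⟨he1, he2⟩, max M₁ M₂, fun ξ hξ => ?_⟩
    obtain ⟨k1, k2⟩ := (add_abs_imJ_lt_re_iff _ _).1 hξ
    apply ext_P
    · rw [P₁_laplace, h₁, hM₁ _ ((le_max_left _ _).trans_lt k1)]
    · rw [P₂_laplace, h₂, hM₂ _ ((le_max_right _ _).trans_lt k2)]

theorem P₁_symb (m n r l ξ : Bicomplex) :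
    P₁ (symb m n r l ξ) = csymb (P₁ m) (P₁ n) (P₁ r) (P₁ l) (P₁ ξ) := by
  simp only [symb, csymb, map_mul, P₁_cpow, map_sub, map_one, map_neg]

theorem P₂_symb (m n r l ξ : Bicomplex) :
    P₂ (symb m n r l ξ) = csymb (P₂ m) (P₂ n) (P₂ r) (P₂ l) (P₂ ξ) := by
  simp only [symb, csymb, map_mul, P₂_cpow, map_sub, map_one, map_neg]

theorem isInvLaplace_one_div_iff (m n r l κ : Bicomplex) (h : ℝ → Bicomplex) :
    IsInvLaplace (fun ξ => 1 / (symb m n r l ξ + κ)) h ↔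
      InvLap (fun z => 1 / (csymb (P₁ m) (P₁ n) (P₁ r) (P₁ l) z + P₁ κ)) (fun t => P₁ (h t)) ∧
      InvLap (fun z => 1 / (csymb (P₂ m) (P₂ n) (P₂ r) (P₂ l) z + P₂ κ)) (fun t => P₂ (h t)) :=
  isInvLaplace_iff
    (fun ξ => by simp only [P₁_div, map_one, map_add, P₁_symb])
    (fun ξ => by simp only [P₂_div, map_one, map_add, P₂_symb])

theorem isInvLaplace_div_iff (m n r l κ : Bicomplex) (q : ℝ → Bicomplex) :
    IsInvLaplace
      (fun ξ => (ξ ^ (n - 1) * (1 - r * ξ ^ (-m)) ^ l) / (symb m n r l ξ + κ)) q ↔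
      InvLap (fun z => z ^ (P₁ n - 1) * (1 - P₁ r * z ^ (-P₁ m)) ^ P₁ l /
        (csymb (P₁ m) (P₁ n) (P₁ r) (P₁ l) z + P₁ κ)) (fun t => P₁ (q t)) ∧
      InvLap (fun z => z ^ (P₂ n - 1) * (1 - P₂ r * z ^ (-P₂ m)) ^ P₂ l /
        (csymb (P₂ m) (P₂ n) (P₂ r) (P₂ l) z + P₂ κ)) (fun t => P₂ (q t)) :=
  isInvLaplace_iff
    (fun ξ => by simp only [P₁_div, map_one, map_add, P₁_symb, map_mul, P₁_cpow, map_sub, map_neg])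
    (fun ξ => by simp only [P₂_div, map_one, map_add, P₂_symb, map_mul, P₂_cpow, map_sub, map_neg])

theorem P₁_regPrabhakarDeriv (m n r l : Bicomplex) (f : ℝ → Bicomplex) (t : ℝ) :
    P₁ (regPrabhakarDeriv m n r l f t) =
      (if (ord₁ n : ℂ) - P₁ n = 0 then 1 else 0) *
          iteratedDeriv (ord₁ n) (fun s => P₁ (f s)) t +
        cconv (ker (P₁ m) (ord₁ n - P₁ n) (P₁ r) (-P₁ l))
          (iteratedDeriv (ord₁ n) (fun s => P₁ (f s))) t := by
  simp only [regPrabhakarDeriv, prabhakarIntegral, map_add, map_mul, P₁_ofIdem, P₁_conv,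
    P₁_prabhakarKernel, derivCeil, bceil, map_sub, map_neg]

theorem P₂_regPrabhakarDeriv (m n r l : Bicomplex) (f : ℝ → Bicomplex) (t : ℝ) :
    P₂ (regPrabhakarDeriv m n r l f t) =
      (if (ord₂ n : ℂ) - P₂ n = 0 then 1 else 0) *
          iteratedDeriv (ord₂ n) (fun s => P₂ (f s)) t +
        cconv (ker (P₂ m) (ord₂ n - P₂ n) (P₂ r) (-P₂ l))
          (iteratedDeriv (ord₂ n) (fun s => P₂ (f s))) t := by
  simp only [regPrabhakarDeriv, prabhakarIntegral, map_add, map_mul, P₂_ofIdem, P₂_conv,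
    P₂_prabhakarKernel, derivCeil, bceil, map_sub, map_neg]

end LaplaceC

end

open LaplaceC

theorem mainTheorem10
    (m n r l κ τ₀ : Bicomplex)
    (hm : |m.imJ| < m.re) (hn : |n.imJ| < n.re)
    (hl : l.IsHyperbolic)
    (hl₁ : 0 < (P₁ l).re ∧ (P₁ l).re < 1) (hl₂ : 0 < (P₂ l).re ∧ (P₂ l).re < 1)
    -- the order `⌈n⌉ - n` of the Prabhakar integral in the derivative has positive real part
    -- or is zero, in each component
    (hn₁ : P₁ n = ord₁ n ∨ (P₁ n).re < ord₁ n)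
    (hn₂ : P₂ n = ord₂ n ∨ (P₂ n).re < ord₂ n)
    (f g : ℝ → Bicomplex) (hf : ExpClass f) (hg : ExpClass g)
    (hf₁ : ACLoc (ord₁ n) (fun t => P₁ (f t))) (hf₂ : ACLoc (ord₂ n) (fun t => P₂ (f t)))
    -- the equation
    (heq : ∀ᵐ t ∂(volume.restrict (Ioi (0 : ℝ))),
      regPrabhakarDeriv m n r l f t + κ * f t = g t)
    -- `f(0+) = τ₀`; the further initial values (present only if some `Re nᵢ > 1`) are zero
    (h0₁ : Tendsto (fun t => P₁ (f t)) (𝓝[>] 0) (𝓝 (P₁ τ₀)))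
    (h0₂ : Tendsto (fun t => P₂ (f t)) (𝓝[>] 0) (𝓝 (P₂ τ₀)))
    (hp₁ : ∀ p : ℕ, 1 ≤ p → p < ord₁ n →
      Tendsto (iteratedDeriv p (fun t => P₁ (f t))) (𝓝[>] 0) (𝓝 0))
    (hp₂ : ∀ p : ℕ, 1 ≤ p → p < ord₂ n →
      Tendsto (iteratedDeriv p (fun t => P₂ (f t))) (𝓝[>] 0) (𝓝 0)) :
    -- both inverse Laplace transforms exist
    (∃ h : ℝ → Bicomplex, IsInvLaplace (fun ξ => 1 / (symb m n r l ξ + κ)) h) ∧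
    (∃ q : ℝ → Bicomplex, IsInvLaplace
      (fun ξ => (ξ ^ (n - 1) * (1 - r * ξ ^ (-m)) ^ l) / (symb m n r l ξ + κ)) q) ∧
    -- the solution formula
    (∀ h q : ℝ → Bicomplex,
      IsInvLaplace (fun ξ => 1 / (symb m n r l ξ + κ)) h →
      IsInvLaplace
        (fun ξ => (ξ ^ (n - 1) * (1 - r * ξ ^ (-m)) ^ l) / (symb m n r l ξ + κ)) q →
      ∀ᵐ t ∂(volume.restrict (Ioi (0 : ℝ))), f t = conv h g t + τ₀ * q t) ∧
    -- the case `κ = 0`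
    (κ = 0 →
      IsInvLaplace (fun ξ => 1 / symb m n r l ξ) (prabhakarKernel m n r l) ∧
      ∀ᵐ t ∂(volume.restrict (Ioi (0 : ℝ))),
        f t = τ₀ + conv (prabhakarKernel m n r l) g t) := by

  obtain ⟨hm₁, hm₂⟩ := re_pos_of_abs_imJ_lt hm
  obtain ⟨hn₁', hn₂'⟩ := re_pos_of_abs_imJ_lt hn
  have hV₁ := volterra_of_regPrabhakar (r := P₁ r) (l := P₁ l) (κ := P₁ κ)
    (g := fun t => P₁ (g t)) hm₁ hn₁' (Nat.one_le_ceil_iff.2 hn₁') hn₁ hf₁ (by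
      filter_upwards [heq] with t ht
      have h := congrArg P₁ ht
      rwa [map_add, map_mul, P₁_regPrabhakarDeriv] at h) h0₁ hp₁
  have hV₂ := volterra_of_regPrabhakar (r := P₂ r) (l := P₂ l) (κ := P₂ κ)
    (g := fun t => P₂ (g t)) hm₂ hn₂' (Nat.one_le_ceil_iff.2 hn₂') hn₂ hf₂ (by
      filter_upwards [heq] with t ht
      have h := congrArg P₂ ht
      rwa [map_add, map_mul, P₂_regPrabhakarDeriv] at h) h0₂ hp₂
  refine ⟨?_, ?_, fun h q hh hq => ?_, fun hκ => ⟨?_, ?_⟩⟩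
  · obtain ⟨a, ha⟩ := exists_invLap_one_div_csymb_add hm₁ hn₁' (P₁ r) (P₁ l) (P₁ κ)
    obtain ⟨b, hb⟩ := exists_invLap_one_div_csymb_add hm₂ hn₂' (P₂ r) (P₂ l) (P₂ κ)
    exact ⟨fun t => ofIdem (a t) (b t), (isInvLaplace_one_div_iff _ _ _ _ _ _).2
      ⟨by simpa only [P₁_ofIdem] using ha, by simpa only [P₂_ofIdem] using hb⟩⟩
  · obtain ⟨a, ha⟩ := exists_invLap_csymb_div_div hm₁ hn₁' (P₁ r) (P₁ l) (P₁ κ)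
    obtain ⟨b, hb⟩ := exists_invLap_csymb_div_div hm₂ hn₂' (P₂ r) (P₂ l) (P₂ κ)
    exact ⟨fun t => ofIdem (a t) (b t), (isInvLaplace_div_iff _ _ _ _ _ _).2
      ⟨by simpa only [P₁_ofIdem] using ha, by simpa only [P₂_ofIdem] using hb⟩⟩
  · obtain ⟨hh₁, hh₂⟩ := (isInvLaplace_one_div_iff _ _ _ _ _ _).1 hh
    obtain ⟨hq₁, hq₂⟩ := (isInvLaplace_div_iff _ _ _ _ _ _).1 hq
    filter_upwards [solution_formula hm₁ hn₁' hf.1 hg.1 hV₁ hh₁ hq₁,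
      solution_formula hm₂ hn₂' hf.2 hg.2 hV₂ hh₂ hq₂] with t h₁ h₂
    apply ext_P
    · rw [map_add, map_mul, P₁_conv, h₁]
    · rw [map_add, map_mul, P₂_conv, h₂]
  · refine (isInvLaplace_iff (fun ξ => ?_) (fun ξ => ?_)).2
      ⟨(invLap_ker_csymb hm₁ hn₁' (P₁ r) (P₁ l)).congr_fun
          fun t _ => (P₁_prabhakarKernel m n r l t).symm,
        (invLap_ker_csymb hm₂ hn₂' (P₂ r) (P₂ l)).congr_fun
          fun t _ => (P₂_prabhakarKernel m n r l t).symm⟩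
    · simp only [P₁_div, map_one, P₁_symb]
    · simp only [P₂_div, map_one, P₂_symb]
  · subst hκ
    filter_upwards [hV₁, hV₂] with t h₁ h₂
    simp only [map_zero, zero_mul, sub_zero] at h₁ h₂
    apply ext_P
    · rw [map_add, P₁_conv, eq_add_of_sub_eq' h₁]
      simp only [P₁_prabhakarKernel]
    · rw [map_add, P₂_conv, eq_add_of_sub_eq' h₂]
      simp only [P₂_prabhakarKernel]
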